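/- Let $X$ be a smooth manifold (Hausdorff, second countable, finite-dimensional, without boundary, possibly non-orientable or disconnected), $l\to X$ a smooth real line bundle and $\nabla$ a flat smooth connection on $l$. For a fibre metric $h$ on $l$ let $\nabla_h$ be the unique connection compatible with $h$, and let $\theta(\nabla,h)=\nabla-\nabla_h$ be the holonomy form, a real $1$-form on $X$ (here $\mathrm{End}\,l$ is identified with the trivial line bundle). Let $\tilde c(\nabla)\in H^1(X,\mathbf R)$ denote the de Rham class $[\theta(\nabla,h)]$; it is independent of $h$. Let $w_1(l)\in H^1(X,\mathbf Z_2)$, $\mathbf Z_2=\{\pm1\}$, be the first Stiefel–Whitney class: for a loop $\rho$, $w_1(l)[\rho]=1$ if and only if $\rho^*l$ is trivial. Let $c(\nabla)\in H^1(X,\mathbf R^*)$ be the holonomy class, defined by parallel transport: $c(\nabla)[\rho]=\mathrm{hol}_\rho(\nabla)$ for loops $\rho$, where $\mathrm{hol}_\rho(\nabla)$ is the product of the transition factors $g_{i,i+1}$, $s_{i+1}=g_{i,i+1}s_i$, of successive $\nabla$-flat frames $s_i$ along $\rho$; equivalently, parallel transport once around $\rho$ is multiplication by $\mathrm{hol}_\rho(\nabla)^{-1}$.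 More precisely, with a nonzero vector $v_x\in l_x$ chosen for each $x\in X$, $c(\nabla)$ is represented by the singular $1$-cocycles $f$ such that parallel transport along each smooth path $\gamma:[0,1]\to X$ sends $v_{\gamma(0)}$ to $f(\gamma)^{-1}v_{\gamma(1)}$. These classes exist and are uniquely determined, and: (a) under the homomorphism $H^1(X,\mathbf R^*)\to H^1(X,\mathbf R)$ induced by $\ln|\cdot|:\mathbf R^*\to\mathbf R$, the class $c(\nabla)$ is mapped to $\tilde c(\nabla)=[\theta(\nabla,h)]$, for every fibre metric $h$; (b) under the homomorphism $H^1(X,\mathbf R^*)\to H^1(X,\mathbf Z_2)$ induced by the sign map $\mathbf R^*\to\{\pm1\}$, the class $c(\nabla)$ is mapped to $w_1(l)$; hence this image does not depend on the flat connection $\nabla$; (c) the homomorphisms $\mathbf Z_2\hookrightarrow\mathbf R^*$ and $\exp:\mathbf R\to\mathbf R^*$ induce an isomorphism of abelian groups $$H^1(X,\mathbf Z_2)\times H^1(X,\mathbf R)\;\xrightarrow{\ \cong\ }\;H^1(X,\mathbf R^*),$$ which maps $(w_1(l),\tilde c(\nabla))$ to $c(\nabla)$. -/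

import Mathlib

open Bundle Set Topology
open scoped Manifold ContDiff

noncomputable section

namespace RealLineBundle

/-! ### Singular cohomology in degree one -/

section Cohomology

variable (X : Type*) [TopologicalSpace X] (A : Type*) [AddCommGroup A]

/-- Singular `k`-simplices of `X`. -/
abbrev Simplex (k : ℕ) : Type _ := C(stdSimplex ℝ (Fin (k + 1)), X)

variable {X} in
/-- The `i`-th face of a singular simplex. -/
def Simplex.face {k : ℕ} (σ : Simplex X (k + 1)) (i : Fin (k + 2)) : Simplex X k :=
  σ.comp ⟨stdSimplex.map i.succAbove, stdSimplex.continuous_map _⟩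

/-- Singular `k`-cochains of `X` with coefficients in `A`. -/
abbrev Cochain (k : ℕ) : Type _ := Simplex X k → A

/-- The singular coboundary `(δ f)(σ) = ∑ i, (-1)^i f(∂ᵢ σ)`. -/
def coboundary (k : ℕ) : Cochain X A k →+ Cochain X A (k + 1) where
  toFun f σ := ∑ i : Fin (k + 2), (-1 : ℤ) ^ (i : ℕ) • f (σ.face i)
  map_zero' := by ext σ; simp
  map_add' f g := by ext σ; simp [Finset.sum_add_distrib]

/-- Singular `1`-cocycles. -/
abbrev cocycles₁ : AddSubgroup (Cochain X A 1) := (coboundary X A 1).ker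

/-- The first singular cohomology group `H¹(X, A)`. -/
def H1 : Type _ := cocycles₁ X A ⧸ (coboundary X A 0).range.addSubgroupOf (cocycles₁ X A)

instance : AddCommGroup (H1 X A) :=
  inferInstanceAs
    (AddCommGroup (cocycles₁ X A ⧸ (coboundary X A 0).range.addSubgroupOf (cocycles₁ X A)))

variable {X A} in
/-- The cohomology class of a singular `1`-cocycle. -/
def H1.mk : cocycles₁ X A →+ H1 X A := QuotientAddGroup.mk' _

variable {A} {B : Type*} [AddCommGroup B]

theorem coboundary_comp (φ : A →+ B) (k : ℕ) (f : Cochain X A k) :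
    coboundary X B k (φ ∘ f) = φ ∘ coboundary X A k f := by
  ext σ
  simp [coboundary]

/-- The map induced on cocycles by a homomorphism of coefficients. -/
def cocyclesMap (φ : A →+ B) : cocycles₁ X A →+ cocycles₁ X B where
  toFun f := ⟨φ ∘ f.1, by
    have hf : coboundary X A 1 f.1 = 0 := f.2
    rw [AddMonoidHom.mem_ker, coboundary_comp, hf]
    ext σ
    simp⟩
  map_zero' := by ext σ; simp
  map_add' f g := by ext σ; simp

/-- The homomorphism `H¹(X, A) → H¹(X, B)` induced by a homomorphism of coefficients `A → B`. -/
def H1.map (φ : A →+ B) : H1 X A →+ H1 X B :=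
  QuotientAddGroup.map _ _ (cocyclesMap X φ) (by
    rintro f ⟨g, hg⟩
    exact ⟨φ ∘ g, by rw [coboundary_comp, hg]; rfl⟩)

end Cohomology

/-! ### The coefficient homomorphisms -/

/-- `ln|·| : ℝˣ → ℝ`. -/
def lnAbs : Additive ℝˣ →+ ℝ where
  toFun a := Real.log |((a.toMul : ℝˣ) : ℝ)|
  map_zero' := by simp
  map_add' a b := by
    simp only [toMul_add, Units.val_mul, abs_mul]
    exact Real.log_mul (by simp) (by simp)

/-- The sign map `ℝˣ → {±1}`. -/
def sign : Additive ℝˣ →+ Additive ℤˣ where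
  toFun a := Additive.ofMul (if 0 < ((a.toMul : ℝˣ) : ℝ) then 1 else -1)
  map_zero' := by simp
  map_add' a b := by
    rw [← ofMul_mul]
    congr 1
    simp only [toMul_add, Units.val_mul]
    rcases lt_or_gt_of_ne a.toMul.ne_zero with ha | ha <;>
      rcases lt_or_gt_of_ne b.toMul.ne_zero with hb | hb
    · simp [mul_pos_of_neg_of_neg ha hb, ha.le, hb.le, not_lt.2]
    · simp [mul_neg_of_neg_of_pos ha hb |>.le, ha.le, hb, not_lt.2]
    · simp [mul_neg_of_pos_of_neg ha hb |>.le, ha, hb.le, not_lt.2]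
    · simp [mul_pos ha hb, ha, hb]

/-- The inclusion `{±1} → ℝˣ`. -/
def signIncl : Additive ℤˣ →+ Additive ℝˣ :=
  MonoidHom.toAdditive (Units.map (Int.castRingHom ℝ : ℤ →* ℝ))

/-- The exponential `ℝ → ℝˣ`. -/
def expHom : ℝ →+ Additive ℝˣ where
  toFun t := Additive.ofMul (Units.mk0 (Real.exp t) (Real.exp_ne_zero t))
  map_zero' := by
    rw [← ofMul_one]; congr 1; ext; simp
  map_add' s t := by
    rw [← ofMul_mul]; congr 1; ext; simp [Real.exp_add]

/-- The homomorphism `H¹(X, {±1}) × H¹(X, ℝ) → H¹(X, ℝˣ)` given by the inclusion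
`{±1} → ℝˣ` and the exponential `ℝ → ℝˣ`. -/
def decomposition (X : Type*) [TopologicalSpace X] :
    H1 X (Additive ℤˣ) × H1 X ℝ →+ H1 X (Additive ℝˣ) :=
  (H1.map X signIncl).coprod (H1.map X expHom)

/-! ### Singular `1`-simplices as paths -/

/-- A singular `1`-simplex as a path `t ↦ σ(1 - t, t)` on `[0, 1]`, extended by constants
to `ℝ`. -/
def path {X : Type*} [TopologicalSpace X] (σ : Simplex X 1) (t : ℝ) : X :=
  σ (stdSimplexHomeomorphUnitInterval.symm (projIcc 0 1 zero_le_one t))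

/-! ### The first Stiefel-Whitney class -/

/-- `w` is the first Stiefel-Whitney class of the real line bundle `l`: for every loop `ρ`,
the value `w[ρ]` is `+1` if and only if the pulled back line bundle `ρ^* l` on the circle is
trivial, that is, has a continuous nowhere vanishing section. -/
def IsFirstStiefelWhitneyClass {X : Type*} [TopologicalSpace X] (l : X → Type*)
    [∀ x, AddCommGroup (l x)] [TopologicalSpace (TotalSpace ℝ l)]
    (w : H1 X (Additive ℤˣ)) : Prop :=
  ∃ f : cocycles₁ X (Additive ℤˣ), H1.mk f = w ∧
    ∀ ρ : Simplex X 1, path ρ 0 = path ρ 1 →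
      (f.1 ρ = 0 ↔ ∃ s : Π t, l (path ρ t),
        ContinuousOn (fun t ↦ TotalSpace.mk' ℝ (path ρ t) (s t)) (Icc 0 1) ∧
        (∀ t ∈ Icc (0 : ℝ) 1, s t ≠ 0) ∧
        TotalSpace.mk' ℝ (path ρ 0) (s 0) = TotalSpace.mk' ℝ (path ρ 1) (s 1))

/-! ### Smooth paths and the de Rham map -/

section Smooth

variable {n : ℕ} {X : Type*} [TopologicalSpace X] [ChartedSpace (EuclideanSpace ℝ (Fin n)) X]

/-- The singular `1`-simplex `σ` is a smooth path. -/
def IsSmoothPath (σ : Simplex X 1) : Prop :=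
  ContMDiffOn 𝓘(ℝ, ℝ) (𝓡 n) ∞ (path σ) (Icc 0 1)

/-- The velocity of the path `σ` at time `t`. -/
def velocity (σ : Simplex X 1) (t : ℝ) : TangentSpace (𝓡 n) (path σ t) :=
  mfderivWithin 𝓘(ℝ, ℝ) (𝓡 n) (path σ) (Icc 0 1) t (1 : ℝ)

/-- `c` is the class of the `1`-form `θ` in `H¹(X, ℝ)` under the de Rham isomorphism: `c` is
represented by a singular cocycle whose value on each smooth path `σ` is `∫_σ θ`. -/
def IsDeRhamClass (θ : Π x : X, TangentSpace (𝓡 n) x →L[ℝ] ℝ) (c : H1 X ℝ) : Prop :=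
  ∃ f : cocycles₁ X ℝ, H1.mk f = c ∧
    ∀ σ : Simplex X 1, IsSmoothPath (n := n) σ →
      f.1 σ = ∫ t in (0 : ℝ)..1, θ (path σ t) (velocity σ t)

/-! ### Connections on a real line bundle -/

variable {l : X → Type*} [TopologicalSpace (TotalSpace ℝ l)]
  [∀ x, AddCommGroup (l x)] [∀ x, Module ℝ (l x)] [∀ x, TopologicalSpace (l x)]
  [∀ x, IsTopologicalAddGroup (l x)] [∀ x, ContinuousSMul ℝ (l x)]
  [FiberBundle ℝ l]

/-- A smooth vector field on `X`. -/
def IsSmoothField [IsManifold (𝓡 n) 1 X] (V : Π x : X, TangentSpace (𝓡 n) x) : Prop :=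
  ContMDiff (𝓡 n) ((𝓡 n).prod 𝓘(ℝ, EuclideanSpace ℝ (Fin n))) ∞
    (fun x ↦ TotalSpace.mk' (EuclideanSpace ℝ (Fin n)) x (V x))

/-- A smooth section of `l`. -/
def IsSmoothSection (s : Π x : X, l x) : Prop :=
  ContMDiff (𝓡 n) ((𝓡 n).prod 𝓘(ℝ, ℝ)) ∞ (fun x ↦ TotalSpace.mk' ℝ x (s x))

/-- The section `s` of `l` is differentiable at `x`. -/
def IsDiffSectionAt (s : Π x : X, l x) (x : X) : Prop :=
  MDifferentiableAt (𝓡 n) ((𝓡 n).prod 𝓘(ℝ, ℝ)) (fun x ↦ TotalSpace.mk' ℝ x (s x)) x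

/-- The connection `D` is flat: its curvature
`R(V, W) s = D_V D_W s - D_W D_V s - D_[V, W] s` vanishes. -/
def IsFlat [IsManifold (𝓡 n) 1 X] (D : CovariantDerivative (𝓡 n) ℝ l) : Prop :=
  ∀ (V W : Π x : X, TangentSpace (𝓡 n) x) (s : Π x : X, l x),
    IsSmoothField V → IsSmoothField W → IsSmoothSection (n := n) s → ∀ x,
      D (fun y ↦ D s y (W y)) x (V x) - D (fun y ↦ D s y (V y)) x (W x)
        - D s x (VectorField.mlieBracket (𝓡 n) V W x) = 0

/-- The section `s` of `l` along the path `σ` is parallel for `D`. Near each time `t`, one has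
`s = u e` along `σ` for a smooth section `e` of `l` with `e ≠ 0` at `σ(t)` and a function `u`;
then the covariant derivative `u' e + u D_{σ'} e` of `s` along `σ` vanishes at `t`. -/
def IsParallelAlong (D : CovariantDerivative (𝓡 n) ℝ l) (σ : Simplex X 1)
    (s : Π t : ℝ, l (path σ t)) : Prop :=
  ∀ t ∈ Icc (0 : ℝ) 1, ∃ (e : Π x : X, l x) (u : ℝ → ℝ) (u' : ℝ),
    IsSmoothSection (n := n) e ∧ e (path σ t) ≠ 0 ∧
    (∀ᶠ r in 𝓝[Icc 0 1] t, s r = u r • e (path σ r)) ∧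
    HasDerivWithinAt u u' (Icc 0 1) t ∧
    u' • e (path σ t) + u t • D e (path σ t) (velocity σ t) = 0

/-- `c` is the holonomy class of the flat connection `D`. Choose a nonzero vector `v x` in each
fibre; `c` is represented by a singular cocycle `f` such that for each smooth path `σ`, parallel
transport along `σ` sends `v (σ 0)` to `(f σ)⁻¹ • v (σ 1)`. In particular, for a smooth loop `ρ`,
parallel transport once around `ρ` is multiplication by `(f ρ)⁻¹`. (So `f ρ` is the product of
the transition factors `g_{i,i+1}`, `s_{i+1} = g_{i,i+1} s_i`, of successive flat frames
`s_i` along `ρ`.) -/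
def IsHolonomyClass (D : CovariantDerivative (𝓡 n) ℝ l) (c : H1 X (Additive ℝˣ)) : Prop :=
  ∃ f : cocycles₁ X (Additive ℝˣ), H1.mk f = c ∧
    ∃ v : Π x : X, l x, (∀ x, v x ≠ 0) ∧
      ∀ σ : Simplex X 1, IsSmoothPath (n := n) σ →
        ∃ s : Π t : ℝ, l (path σ t), IsParallelAlong D σ s ∧ s 0 = v (path σ 0) ∧
          v (path σ 1) = ((f.1 σ).toMul : ℝ) • s 1

/-! ### Fibre metrics and the holonomy form -/

variable [VectorBundle ℝ ℝ l]

set_option linter.unusedSectionVars false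

/-- The connection `D` is compatible with the fibre metric `h`:
`d h(s, t) = h(D s, t) + h(s, D t)`. -/
def IsCompatible (D : CovariantDerivative (𝓡 n) ℝ l)
    (h : ContMDiffRiemannianMetric (𝓡 n) ∞ ℝ l) : Prop :=
  ∀ (s t : Π x : X, l x) (x : X), IsDiffSectionAt (n := n) s x → IsDiffSectionAt (n := n) t x →
    ∀ V : TangentSpace (𝓡 n) x,
      mvfderiv (𝓡 n) (fun y ↦ h.inner y (s y) (t y)) x V
        = h.inner x (D s x V) (t x) + h.inner x (s x) (D t x V)

theorem mdifferentiableAt_inner (h : ContMDiffRiemannianMetric (𝓡 n) ∞ ℝ l)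
    {s t : Π x : X, l x} {x : X} (hs : IsDiffSectionAt (n := n) s x)
    (ht : IsDiffSectionAt (n := n) t x) :
    MDifferentiableAt (𝓡 n) 𝓘(ℝ, ℝ) (fun y ↦ h.inner y (s y) (t y)) x := by
  have h1 : MDifferentiableAt (𝓡 n) ((𝓡 n).prod 𝓘(ℝ, ℝ))
      (fun m ↦ TotalSpace.mk' ℝ (E := Bundle.Trivial X ℝ) m (h.inner m (s m) (t m))) x := by
    apply MDifferentiableAt.clm_bundle_apply₂ (F₁ := ℝ) (F₂ := ℝ)
    · exact h.contMDiff.mdifferentiableAt (by simp)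
    · exact hs
    · exact ht
  simp only [mdifferentiableAt_totalSpace] at h1
  exact h1.2

theorem exists_smul_eq {x : X} {e : l x} (he : e ≠ 0) (v : l x) : ∃ a : ℝ, v = a • e := by
  let L := (trivializationAt ℝ l x).continuousLinearEquivAt ℝ x
    (FiberBundle.mem_baseSet_trivializationAt' x)
  have hL : L e ≠ 0 := by simpa using he
  refine ⟨L v / L e, L.injective ?_⟩
  simp [hL]

theorem inner_mul_inner (h : ContMDiffRiemannianMetric (𝓡 n) ∞ ℝ l) {x : X} {e : l x}
    (he : e ≠ 0) (v w : l x) :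
    h.inner x v e * h.inner x w e = h.inner x v w * h.inner x e e := by
  obtain ⟨a, rfl⟩ := exists_smul_eq he v
  obtain ⟨b, rfl⟩ := exists_smul_eq he w
  simp
  ring

variable [ContMDiffVectorBundle ∞ ℝ l (𝓡 n)]

/-- On a real line bundle with a fibre metric there is a compatible connection. -/
theorem exists_isCompatible (h : ContMDiffRiemannianMetric (𝓡 n) ∞ ℝ l) :
    ∃ D : CovariantDerivative (𝓡 n) ℝ l, IsCompatible D h := by
  have : ContMDiffVectorBundle 1 ℝ l (𝓡 n) := ContMDiffVectorBundle.of_le (n := ∞) (by simp)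
  have key : ∀ x : X, ∃ e : Π y : X, l y, IsDiffSectionAt (n := n) e x ∧ e x ≠ 0 := by
    intro x
    let L := (trivializationAt ℝ l x).continuousLinearEquivAt ℝ x
      (FiberBundle.mem_baseSet_trivializationAt' x)
    refine ⟨FiberBundle.extend ℝ (L.symm 1),
      FiberBundle.mdifferentiableAt_extend (𝓡 n) ℝ _, ?_⟩
    rw [FiberBundle.extend_apply_self]
    simp
  choose e hed he0 using key
  -- `c x s y = h(s, e / |e|)(y)` for the frame `e = e x` around `x`
  let c : X → (Π y, l y) → X → ℝ := fun x s y ↦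
    h.inner y (s y) (e x y) * (Real.sqrt (h.inner y (e x y) (e x y)))⁻¹
  have hpos : ∀ x, 0 < h.inner x (e x x) (e x x) := fun x ↦ h.pos x _ (he0 x)
  have hcd : ∀ x s, IsDiffSectionAt (n := n) s x →
      MDifferentiableAt (𝓡 n) 𝓘(ℝ, ℝ) (c x s) x := by
    intro x s hs
    have h1 := mdifferentiableAt_inner h hs (hed x)
    have h2 := mdifferentiableAt_inner h (hed x) (hed x)
    have h3 : DifferentiableAt ℝ (fun r : ℝ ↦ (Real.sqrt r)⁻¹) (h.inner x (e x x) (e x x)) := by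
      have := hpos x
      exact ((Real.hasDerivAt_sqrt this.ne').differentiableAt).inv (by positivity)
    exact h1.mul (h3.comp_mdifferentiableAt (f := fun y ↦ h.inner y (e x y) (e x y)) h2)
  let D : CovariantDerivative (𝓡 n) ℝ l :=
    { toFun := fun s x ↦ (mvfderiv (𝓡 n) (c x s) x).smulRight
        ((Real.sqrt (h.inner x (e x x) (e x x)))⁻¹ • e x x)
      isCovariantDerivativeOnUniv := by
        refine ⟨fun {s s' x} hs hs' _ ↦ ?_, fun {s g x} hs hg _ ↦ ?_⟩
        · have : c x (s + s') = c x s + c x s' := by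
            ext y; simp [c]; ring
          rw [this, mvfderiv_add (hcd x s hs) (hcd x s' hs')]
          ext V; simp [add_smul]
        · have : c x (g • s) = g * c x s := by
            ext y; simp [c]; ring
          rw [this, mvfderiv_mul hg (hcd x s hs)]
          obtain ⟨a, ha⟩ := exists_smul_eq (he0 x) (s x)
          have hcx : (c x s x) • ((Real.sqrt (h.inner x (e x x) (e x x)))⁻¹ • e x x) = s x := by
            have h4 := Real.mul_self_sqrt (hpos x).le
            have h5 : Real.sqrt (h.inner x (e x x) (e x x)) ≠ 0 := (Real.sqrt_pos.2 (hpos x)).ne'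
            simp only [c, ha, smul_smul, map_smul, _root_.smul_apply, smul_eq_mul]
            congr 1
            field_simp
            rw [sq, h4]
          have h6 : ∀ p q r : ℝ, p * q * r = q * (p * r) := fun p q r ↦ by ring
          ext V
          simp [add_smul]
          rw [← hcx]
          simp only [smul_smul]
          congr 2
          · exact mul_assoc _ _ _
          · exact h6 _ _ _ }
  refine ⟨D, fun s t x hs ht V ↦ ?_⟩
  have hcont : ∀ᶠ y in 𝓝 x, 0 < h.inner y (e x y) (e x y) :=
    (mdifferentiableAt_inner h (hed x) (hed x)).continuousAt.eventually_const_lt (hpos x)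
  have heq : (fun y ↦ h.inner y (s y) (t y)) =ᶠ[𝓝 x] c x s * c x t := by
    filter_upwards [hcont] with y hy
    have hey : e x y ≠ 0 := by
      intro h0
      simp [h0] at hy
    have h4 := Real.mul_self_sqrt hy.le
    have h5 : Real.sqrt (h.inner y (e x y) (e x y)) ≠ 0 := (Real.sqrt_pos.2 hy).ne'
    have h6 := inner_mul_inner h hey (s y) (t y)
    simp only [c, Pi.mul_apply]
    field_simp
    rw [h6, sq, h4]
  have hd : mvfderiv (𝓡 n) (fun y ↦ h.inner y (s y) (t y)) x
      = mvfderiv (𝓡 n) (c x s * c x t) x := by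
    simp only [mvfderiv, heq.mfderiv_eq]
    rw [heq.eq_of_nhds]
    rfl
  rw [hd, mvfderiv_mul (hcd x s hs) (hcd x t ht)]
  have hsymm := h.symm x (s x) (e x x)
  have hsymm' := h.symm x (t x) (e x x)
  simp [D, c, hsymm, hsymm']
  ring

/-- The connection `∇_h` compatible with the fibre metric `h`. -/
def metricConnection (h : ContMDiffRiemannianMetric (𝓡 n) ∞ ℝ l) :
    CovariantDerivative (𝓡 n) ℝ l :=
  (exists_isCompatible h).choose

/-- The holonomy form `θ(D, h) = D - ∇_h`, where the endomorphisms of the fibres of `l` are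
identified with real numbers by the trace. -/
def holonomyForm [IsManifold (𝓡 n) 1 X]
    (D : CovariantDerivative (𝓡 n) ℝ l)
    (h : ContMDiffRiemannianMetric (𝓡 n) ∞ ℝ l) (x : X) : TangentSpace (𝓡 n) x →L[ℝ] ℝ :=
  haveI : FiniteDimensional ℝ (TangentSpace (𝓡 n) x) :=
    inferInstanceAs (FiniteDimensional ℝ (EuclideanSpace ℝ (Fin n)))
  haveI : T2Space (TangentSpace (𝓡 n) x) :=
    inferInstanceAs (T2Space (EuclideanSpace ℝ (Fin n)))
  haveI : ContMDiffVectorBundle 1 ℝ l (𝓡 n) := ContMDiffVectorBundle.of_le (n := ∞) (by simp)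
  LinearMap.toContinuousLinearMap
    (LinearMap.trace ℝ (l x) ∘ₗ
      LinearMap.flip (R := ℝ) (ContinuousLinearMap.coeLM ℝ ∘ₗ
        (D.difference (metricConnection h) x).toLinearMap))

end Smooth

end RealLineBundle

end

noncomputable section

namespace RealLineBundle

/-! ### Singular `1`-cocycles and paths -/

section Cocycles

variable {X : Type*} [TopologicalSpace X] {A : Type*} [AddCommGroup A]

/-! Everything is read off from a single cocycle. Flatness provides local flat frames `e x`: if `D
e₀ = Ω e₀`, vanishing curvature says that `Ω` is closed, the Poincaré lemma on a chart ball gives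
`dg = Ω`, and `exp(-g) e₀` is flat (`exists_flat_frame`). Quotients of flat frames are locally
constant. Fix nonzero vectors `v x`, with no continuity required. The quotients `v / e x` are then
local potentials in `ℝˣ` whose differences are locally constant, and integrating them along paths by
covering space theory gives a cocycle `f σ = u 1 - u 0` (`exists_cocycle_of_isLocalPotential`).

Along a path, `u⁻¹ v` is locally a constant multiple of a flat frame. This one section gives `f`
three meanings. It is parallel, so `f` is the holonomy (`isHolonomyClass_iff`). It is continuous and
nowhere zero, so over a loop the bundle is trivial exactly when `f > 0`
(`isFirstStiefelWhitneyClass`). The logarithm of its norm has derivative `-θ`, so `∫ θ` is `ln|f|`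
up to a coboundary (`isDeRhamClass_iff`).

Uniqueness of the holonomy and de Rham classes requires that a cocycle be determined by its values
on smooth paths (`cocycle_ext_of_smooth`): a short path is homotopic, within a chart ball, to a
straight chord. For the Stiefel-Whitney class, values on loops suffice (`H1_mk_eq_of_loops`). Part
(c) is the splitting `x = sign(x) exp(ln|x|)` of the coefficient group. -/

theorem continuous_path (σ : Simplex X 1) : Continuous (path σ) :=
  σ.continuous.comp (stdSimplexHomeomorphUnitInterval.symm.continuous.comp continuous_projIcc)

theorem path_of_le_zero (σ : Simplex X 1) {t : ℝ} (ht : t ≤ 0) : path σ t = path σ 0 := by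
  simp [path, projIcc_of_le_left _ ht]

theorem path_of_one_le (σ : Simplex X 1) {t : ℝ} (ht : 1 ≤ t) : path σ t = path σ 1 := by
  simp [path, projIcc_of_right_le _ ht]

theorem apply_eq_path (σ : Simplex X 1) (w : stdSimplex ℝ (Fin 2)) : σ w = path σ (w 1) := by
  have h : projIcc (0 : ℝ) 1 zero_le_one (w 1) = stdSimplexHomeomorphUnitInterval w := by
    rw [projIcc_of_mem zero_le_one ⟨stdSimplex.zero_le w 1, stdSimplex.le_one w 1⟩]
    rfl
  rw [path, h, Homeomorph.symm_apply_apply]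

theorem apply_vertex_zero (σ : Simplex X 1) : σ (stdSimplex.vertex 0) = path σ 0 := by
  rw [apply_eq_path]; simp

theorem apply_vertex_one (σ : Simplex X 1) : σ (stdSimplex.vertex 1) = path σ 1 := by
  rw [apply_eq_path]; simp

theorem face_apply_vertex {k : ℕ} (τ : Simplex X (k + 1)) (i : Fin (k + 2)) (j : Fin (k + 1)) :
    τ.face i (stdSimplex.vertex j) = τ (stdSimplex.vertex (i.succAbove j)) := by
  simp [Simplex.face]

theorem simplex_ext {σ τ : Simplex X 1} (h : ∀ t ∈ Icc (0 : ℝ) 1, path σ t = path τ t) :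
    σ = τ := by
  ext w
  rw [apply_eq_path, apply_eq_path]
  exact h _ ⟨stdSimplex.zero_le w 1, stdSimplex.le_one w 1⟩

variable {E : Type*} [AddCommGroup E] [Module ℝ E] [TopologicalSpace E] [ContinuousAdd E]
  [ContinuousSMul ℝ E]

/-- The affine singular simplex with given vertices. -/
def affineSimplex {k : ℕ} (p : Fin (k + 1) → E) : C(stdSimplex ℝ (Fin (k + 1)), E) where
  toFun w := ∑ i, w i • p i
  continuous_toFun := by
    refine continuous_finsetSum _ fun i _ ↦ Continuous.smul ?_ continuous_const
    exact (continuous_apply i).comp continuous_subtype_val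

theorem face_comp_affineSimplex {k : ℕ} (G : C(E, X)) (p : Fin (k + 2) → E) (i : Fin (k + 2)) :
    Simplex.face (G.comp (affineSimplex p)) i = G.comp (affineSimplex (p ∘ i.succAbove)) := by
  ext w
  simp only [Simplex.face, affineSimplex, ContinuousMap.comp_apply, ContinuousMap.coe_mk]
  congr 1
  rw [Fin.sum_univ_succAbove _ i]
  have h1 : (stdSimplex.map i.succAbove w) i = 0 := by
    simp [FunOnFinite.linearMap_apply_apply]
  have h2 : ∀ j, (stdSimplex.map i.succAbove w) (i.succAbove j) = w j := by
    intro j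
    simp [FunOnFinite.linearMap_apply_apply, Finset.sum_filter]
  simp [h1, h2]

/-- The path `t ↦ G ((1 - t) a + t b)` as a singular `1`-simplex. -/
def segmentSimplex (G : C(E, X)) (a b : E) : Simplex X 1 := G.comp (affineSimplex ![a, b])

theorem path_segmentSimplex (G : C(E, X)) (a b : E) {t : ℝ} (ht : t ∈ Icc (0 : ℝ) 1) :
    path (segmentSimplex G a b) t = G ((1 - t) • a + t • b) := by
  simp [path, segmentSimplex, affineSimplex, projIcc_of_mem _ ht]
  rfl

theorem cocycle_face (f : cocycles₁ X A) (τ : Simplex X 2) :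
    f.1 (τ.face 2) + f.1 (τ.face 0) = f.1 (τ.face 1) := by
  have h : coboundary X A 1 f.1 τ = 0 := by
    have : coboundary X A 1 f.1 = 0 := f.2
    rw [this]; rfl
  simp [coboundary, Fin.sum_univ_three] at h
  rw [← sub_eq_zero, ← h]
  abel

/-- The cocycle condition on the affine triangle `a, b, c`, pushed forward by `G`. Reversal,
concatenation and homotopy invariance all follow by choosing `E` and `G`. -/
theorem cocycle_segment_add (f : cocycles₁ X A) (G : C(E, X)) (a b c : E) :
    f.1 (segmentSimplex G a b) + f.1 (segmentSimplex G b c) = f.1 (segmentSimplex G a c) := by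
  have h := cocycle_face f (G.comp (affineSimplex ![a, b, c]))
  simp only [face_comp_affineSimplex] at h
  have h0 : (![a, b, c] ∘ (0 : Fin 3).succAbove) = ![b, c] := by
    ext i; fin_cases i <;> rfl
  have h1 : (![a, b, c] ∘ (1 : Fin 3).succAbove) = ![a, c] := by
    ext i; fin_cases i <;> rfl
  have h2 : (![a, b, c] ∘ (2 : Fin 3).succAbove) = ![a, b] := by
    ext i; fin_cases i <;> rfl
  rw [h0, h1, h2] at h
  exact h

theorem cocycle_segment_self (f : cocycles₁ X A) (G : C(E, X)) (a : E) :
    f.1 (segmentSimplex G a a) = 0 := by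
  simpa using cocycle_segment_add f G a a a

theorem cocycle_segment_of_const (f : cocycles₁ X A) (G : C(E, X)) (a b : E)
    (h : ∀ t ∈ Icc (0 : ℝ) 1, G ((1 - t) • a + t • b) = G a) :
    f.1 (segmentSimplex G a b) = 0 := by
  have : segmentSimplex G a b = segmentSimplex G a a := by
    refine simplex_ext fun t ht ↦ ?_
    rw [path_segmentSimplex _ _ _ ht, path_segmentSimplex _ _ _ ht, h t ht, ← add_smul]
    simp
  rw [this, cocycle_segment_self]

/-- A path as a continuous map on `ℝ`. -/
def pathMap (σ : Simplex X 1) : C(ℝ, X) := ⟨path σ, continuous_path σ⟩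

theorem segmentSimplex_pathMap (σ : Simplex X 1) : segmentSimplex (pathMap σ) 0 1 = σ := by
  refine simplex_ext fun t ht ↦ ?_
  rw [path_segmentSimplex _ _ _ ht]
  simp [pathMap]

/-- Cocycles are invariant under homotopies of paths with fixed endpoints. -/
theorem cocycle_eq_of_homotopy (f : cocycles₁ X A) (H : C(ℝ × ℝ, X))
    (h0 : ∀ s ∈ Icc (0 : ℝ) 1, H (0, s) = H (0, 0))
    (h1 : ∀ s ∈ Icc (0 : ℝ) 1, H (1, s) = H (1, 0)) :
    f.1 (segmentSimplex H (0, 0) (1, 0)) = f.1 (segmentSimplex H (0, 1) (1, 1)) := by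
  have e0 : f.1 (segmentSimplex H (0, 0) (0, 1)) = 0 :=
    cocycle_segment_of_const f H _ _ fun t ht ↦ by simpa using h0 t ht
  have e1 : f.1 (segmentSimplex H (1, 0) (1, 1)) = 0 :=
    cocycle_segment_of_const f H _ _ fun t ht ↦ by simpa using h1 t ht
  -- Both ways around the square agree with its diagonal; the vertical sides are constant paths and
  -- contribute nothing.
  have e2 := cocycle_segment_add f H (0, 0) (1, 0) (1, 1)
  have e3 := cocycle_segment_add f H (0, 0) (0, 1) (1, 1)
  rw [e1, add_zero] at e2
  rw [e0, zero_add] at e3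
  rw [e2, e3]

/-- A cocycle that vanishes on all sufficiently small paths is zero. -/
theorem cocycle_eq_zero_of_locally (f : cocycles₁ X A)
    (h : ∀ x : X, ∃ U ∈ 𝓝 x, ∀ σ : Simplex X 1, (∀ t ∈ Icc (0 : ℝ) 1, path σ t ∈ U) → f.1 σ = 0) :
    f = 0 := by
  ext σ
  change f.1 σ = 0
  -- The value on the initial piece from `0` to `t` is locally constant in `t`, since a short extra
  -- piece contributes zero. It vanishes at `t = 0`, hence also at `t = 1`.
  let g : ℝ → A := fun t ↦ f.1 (segmentSimplex (pathMap σ) 0 t)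
  have hg : IsLocallyConstant g := by
    rw [IsLocallyConstant.iff_eventually_eq]
    intro t
    obtain ⟨U, hU, hfU⟩ := h (path σ t)
    obtain ⟨δ, hδ, hball⟩ := Metric.mem_nhds_iff.1 ((continuous_path σ).continuousAt hU)
    filter_upwards [Metric.ball_mem_nhds t hδ] with r hr
    have e := cocycle_segment_add f (pathMap σ) 0 t r
    rw [hfU (segmentSimplex (pathMap σ) t r), add_zero] at e
    · exact e.symm
    · intro s hs
      rw [path_segmentSimplex _ _ _ hs]
      apply hball
      exact (convex_ball t δ) (Metric.mem_ball_self hδ) hr (by linarith [hs.2]) hs.1 (by ring)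
  have h01 := hg.apply_eq_of_isPreconnected isPreconnected_univ (mem_univ 1) (mem_univ 0)
  simp only [g, segmentSimplex_pathMap, cocycle_segment_self] at h01
  exact h01

theorem exists_simplex {γ : ℝ → X} (hγ : ContinuousOn γ (Icc 0 1)) :
    ∃ σ : Simplex X 1, ∀ t ∈ Icc (0 : ℝ) 1, path σ t = γ t := by
  refine ⟨(⟨_, hγ.domRestrict⟩ : C(Icc (0 : ℝ) 1, X)).comp
    ⟨_, stdSimplexHomeomorphUnitInterval.continuous⟩, fun t ht ↦ ?_⟩
  simp [path, projIcc_of_mem _ ht]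

/-- Cocycles are additive under concatenation of paths. -/
theorem exists_concat (σ τ : Simplex X 1) (h : path σ 1 = path τ 0) :
    ∃ ρ : Simplex X 1, path ρ 0 = path σ 0 ∧ path ρ 1 = path τ 1 ∧
      ∀ f : cocycles₁ X A, f.1 ρ = f.1 σ + f.1 τ := by
  let G : C(ℝ, X) := ⟨fun t ↦ if t ≤ 1 then path σ t else path τ (t - 1), by
    refine Continuous.if_le (continuous_path σ)
      ((continuous_path τ).comp (continuous_id.sub continuous_const)) continuous_id
      continuous_const ?_
    rintro t rfl
    simpa using h⟩
  have hσ : segmentSimplex G 0 1 = σ := by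
    refine simplex_ext fun t ht ↦ ?_
    rw [path_segmentSimplex _ _ _ ht]
    simp [G, ht.2]
  have hτ : segmentSimplex G 1 2 = τ := by
    refine simplex_ext fun t ht ↦ ?_
    rw [path_segmentSimplex _ _ _ ht]
    have : (1 - t) • (1 : ℝ) + t • (2 : ℝ) = t + 1 := by simp; ring
    rw [this]
    rcases ht.1.eq_or_lt with rfl | h0
    · simp [G, h]
    · simp [G, not_le.2 h0]
  refine ⟨segmentSimplex G 0 2, ?_, ?_, fun f ↦ ?_⟩
  · rw [path_segmentSimplex _ _ _ (by simp)]
    simp [G]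
  · rw [path_segmentSimplex _ _ _ (by simp)]
    norm_num [G]
  · rw [← cocycle_segment_add f G 0 1 2, hσ, hτ]

theorem exists_reverse (σ : Simplex X 1) :
    ∃ ρ : Simplex X 1, path ρ 0 = path σ 1 ∧ path ρ 1 = path σ 0 ∧
      ∀ f : cocycles₁ X A, f.1 ρ = -f.1 σ := by
  refine ⟨segmentSimplex (pathMap σ) 1 0, ?_, ?_, fun f ↦ ?_⟩
  · rw [path_segmentSimplex _ _ _ (by simp)]
    simp [pathMap]
  · rw [path_segmentSimplex _ _ _ (by simp)]
    simp [pathMap]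
  · have := cocycle_segment_add f (pathMap σ) 0 1 0
    rw [segmentSimplex_pathMap, cocycle_segment_self] at this
    exact eq_neg_of_add_eq_zero_right this

theorem coboundary_zero_apply (g : X → A) (σ : Simplex X 1) :
    coboundary X A 0 (fun p ↦ g (p (stdSimplex.vertex 0))) σ = g (path σ 1) - g (path σ 0) := by
  have h0 : ((stdSimplex.map (0 : Fin 2).succAbove) (stdSimplex.vertex (S := ℝ) (0 : Fin 1))) 1
      = 1 := by simp
  have h1 : ((stdSimplex.map (1 : Fin 2).succAbove) (stdSimplex.vertex (S := ℝ) (0 : Fin 1))) 1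
      = 0 := by simp
  simp only [coboundary, AddMonoidHom.coe_mk, ZeroHom.coe_mk, Simplex.face,
    ContinuousMap.comp_apply, ContinuousMap.coe_mk, apply_eq_path]
  simp [sub_eq_add_neg]

/-- The standard `0`-simplex is a point, so `0`-cochains are functions on `X`. -/
theorem cochain_zero_apply {B : Type*} (h : Cochain X B 0) (p : Simplex X 0) :
    h p = h (ContinuousMap.const _ (p (stdSimplex.vertex 0))) := by
  congr 1
  ext w
  have : w = stdSimplex.vertex 0 := by
    have : Unique (Fin (0 + 1)) := inferInstanceAs (Unique (Fin 1))
    ext i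
    rw [stdSimplex.eq_one_of_unique, stdSimplex.eq_one_of_unique]
  rw [this]
  rfl

theorem mem_range_coboundary_iff {f : Cochain X A 1} :
    f ∈ (coboundary X A 0).range ↔ ∃ g : X → A, ∀ σ, f σ = g (path σ 1) - g (path σ 0) := by
  constructor
  · rintro ⟨h, rfl⟩
    refine ⟨fun x ↦ h (ContinuousMap.const _ x), fun σ ↦ ?_⟩
    refine Eq.trans ?_ (coboundary_zero_apply (fun x ↦ h (ContinuousMap.const _ x)) σ)
    exact congrArg (fun h' ↦ coboundary X A 0 h' σ) (funext (cochain_zero_apply h))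
  · rintro ⟨g, hg⟩
    exact ⟨_, funext fun σ ↦ (coboundary_zero_apply g σ).trans (hg σ).symm⟩

theorem H1_mk_eq_iff {f f' : cocycles₁ X A} :
    H1.mk f = H1.mk f' ↔
      ∃ g : X → A, ∀ σ, f'.1 σ = f.1 σ + (g (path σ 1) - g (path σ 0)) := by
  refine (QuotientAddGroup.eq (s := (coboundary X A 0).range.addSubgroupOf (cocycles₁ X A))).trans ?_
  rw [AddSubgroup.mem_addSubgroupOf, mem_range_coboundary_iff]
  refine exists_congr fun g ↦ forall_congr' fun σ ↦ ?_
  simp [neg_add_eq_iff_eq_add]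

theorem H1_mk_surjective : Function.Surjective (H1.mk : cocycles₁ X A → H1 X A) :=
  QuotientAddGroup.mk'_surjective _

/-- Changing a cocycle by the coboundary of a function on `X`. -/
theorem exists_cocycle_add_coboundary (f : cocycles₁ X A) (g : X → A) :
    ∃ f' : cocycles₁ X A, H1.mk f' = H1.mk f ∧
      ∀ σ, f'.1 σ = f.1 σ + (g (path σ 1) - g (path σ 0)) := by
  have hd : ∀ σ, coboundary X A 0 (fun p ↦ g (p (stdSimplex.vertex 0))) σ
      = g (path σ 1) - g (path σ 0) := coboundary_zero_apply g
  have hmem : f.1 + coboundary X A 0 (fun p ↦ g (p (stdSimplex.vertex 0))) ∈ cocycles₁ X A := by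
    refine add_mem f.2 ?_
    rw [AddMonoidHom.mem_ker]
    ext τ
    have e01 : path (τ.face 0) 0 = path (τ.face 2) 1 := by
      rw [← apply_vertex_zero, ← apply_vertex_one, face_apply_vertex, face_apply_vertex]; rfl
    have e02 : path (τ.face 0) 1 = path (τ.face 1) 1 := by
      rw [← apply_vertex_one, ← apply_vertex_one, face_apply_vertex, face_apply_vertex]; rfl
    have e12 : path (τ.face 1) 0 = path (τ.face 2) 0 := by
      rw [← apply_vertex_zero, ← apply_vertex_zero, face_apply_vertex, face_apply_vertex]; rfl
    change ∑ i : Fin 3, (-1 : ℤ) ^ (i : ℕ) •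
      coboundary X A 0 (fun p ↦ g (p (stdSimplex.vertex 0))) (τ.face i) = 0
    simp only [hd, Fin.sum_univ_three, e01, e02, e12]
    simp
  refine ⟨⟨_, hmem⟩, (H1_mk_eq_iff.2 ⟨g, fun σ ↦ ?_⟩).symm, fun σ ↦ ?_⟩
  · rw [← hd]; rfl
  · rw [← hd]; rfl

/-- A cocycle that vanishes on all loops is a coboundary. -/
theorem H1_mk_eq_of_loops {f f' : cocycles₁ X A}
    (h : ∀ ρ : Simplex X 1, path ρ 0 = path ρ 1 → f.1 ρ = f'.1 ρ) : H1.mk f = H1.mk f' := by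
  -- Running along `σ` and back along `τ` is a loop, so the difference `f' - f` depends only on
  -- endpoints.
  have hend : ∀ σ τ : Simplex X 1, path σ 0 = path τ 0 → path σ 1 = path τ 1 →
      (f' - f).1 σ = (f' - f).1 τ := by
    intro σ τ h0 h1
    obtain ⟨τ', h0', h1', hτ'⟩ := exists_reverse (A := A) τ
    obtain ⟨ρ, hρ0, hρ1, hρ⟩ := exists_concat (A := A) σ τ' (h1.trans h0'.symm)
    have hl := h ρ (by rw [hρ0, hρ1, h1', h0])
    have hz : (f' - f).1 ρ = 0 := by simp [hl]
    rw [hρ, hτ', ← sub_eq_add_neg, sub_eq_zero] at hz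
    exact hz
  -- One base point in each path component. The value of `f' - f` on a chosen path from the base
  -- point to `x` is the function whose coboundary is `f' - f`.
  let base : X → X := fun x ↦ (Quotient.out (Quotient.mk (pathSetoid X) x) : X)
  have hbase : ∀ x, ∃ γ : Simplex X 1, path γ 0 = base x ∧ path γ 1 = x := by
    intro x
    have hx : Joined (base x) x := Quotient.exact (Quotient.out_eq (Quotient.mk (pathSetoid X) x))
    let p := hx.somePath
    obtain ⟨γ, hγ⟩ := exists_simplex p.continuous_extend.continuousOn
    exact ⟨γ, by rw [hγ 0 (by simp)]; simp, by rw [hγ 1 (by simp)]; simp⟩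
  choose γ hγ0 hγ1 using hbase
  refine H1_mk_eq_iff.2 ⟨fun x ↦ (f' - f).1 (γ x), fun σ ↦ ?_⟩
  have hb : base (path σ 0) = base (path σ 1) := by
    have : Joined (path σ 0) (path σ 1) := by
      refine ⟨⟨⟨fun t ↦ path σ t, (continuous_path σ).comp continuous_subtype_val⟩, ?_, ?_⟩⟩ <;> simp
    simp only [base]
    rw [Quotient.sound this]
  obtain ⟨ρ, hρ0, hρ1, hρ⟩ := exists_concat (A := A) (γ (path σ 0)) σ (hγ1 _)
  have := hend ρ (γ (path σ 1)) (by rw [hρ0, hγ0, hγ0, hb]) (by rw [hρ1, hγ1])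
  rw [hρ] at this
  simp only
  rw [← this]
  simp

end Cocycles

/-! ### Cocycles from local potentials -/

section Potentials

variable {X : Type*} {A : Type*} [AddCommGroup A]
  {Y : Type*} [TopologicalSpace Y]

/-- The function `u` is a primitive along `g` of the local potentials `φ`: it differs from each
of them by locally constant functions. -/
def IsPrimitiveAlong (U : X → Set X) (φ : X → X → A) (g : Y → X) (u : Y → A) : Prop :=
  ∀ x y, g y ∈ U x → ∀ᶠ z in 𝓝 y, u z - φ x (g z) = u y - φ x (g y)

variable {U : X → Set X} {φ : X → X → A}

theorem IsPrimitiveAlong.comp {Z : Type*} [TopologicalSpace Z] {g : Y → X} {u : Y → A}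
    (hu : IsPrimitiveAlong U φ g u) {p : Z → Y} (hp : Continuous p) :
    IsPrimitiveAlong U φ (g ∘ p) (u ∘ p) :=
  fun x z hz ↦ (hp.tendsto z).eventually (hu x (p z) hz)

variable [TopologicalSpace X]

/-- A family of `A`-valued functions `φ x`, on open neighbourhoods `U x` of the points `x`, whose
differences are locally constant on the overlaps. -/
structure IsLocalPotential (U : X → Set X) (φ : X → X → A) : Prop where
  isOpen : ∀ x, IsOpen (U x)
  mem : ∀ x, x ∈ U x
  eventually_sub_eq : ∀ x y, ∀ z ∈ U x ∩ U y, ∀ᶠ w in 𝓝 z, φ x w - φ y w = φ x z - φ y z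

/-- Two primitives differ by a locally constant function, which is constant on a preconnected space.
-/
theorem IsPrimitiveAlong.sub_eq [PreconnectedSpace Y] {g : Y → X} {u u' : Y → A}
    (hφ : IsLocalPotential U φ) (hu : IsPrimitiveAlong U φ g u)
    (hu' : IsPrimitiveAlong U φ g u') (y z : Y) : u y - u z = u' y - u' z := by
  have h : IsLocallyConstant (u - u') := by
    rw [IsLocallyConstant.iff_eventually_eq]
    intro y
    filter_upwards [hu _ y (hφ.mem (g y)), hu' _ y (hφ.mem (g y))] with z h1 h2
    have := congrArg₂ (· - ·) h1 h2
    simpa using this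
  have h2 := h.apply_eq_of_isPreconnected isPreconnected_univ (mem_univ y) (mem_univ z)
  simp only [Pi.sub_apply] at h2
  rw [sub_eq_iff_eq_add] at h2
  rw [h2]; abel

/-- The principal bundle with discrete structure group `A` defined by local potentials. -/
def potentialCore (hφ : IsLocalPotential U φ) [TopologicalSpace A] [DiscreteTopology A] :
    FiberBundleCore X X A where
  baseSet := U
  isOpen_baseSet := hφ.isOpen
  indexAt := id
  mem_baseSet_at := hφ.mem
  coordChange i j x a := a + (φ i x - φ j x)
  coordChange_self := by simp
  continuousOn_coordChange i j := by
    rintro ⟨z, a⟩ ⟨hz, -⟩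
    refine ContinuousAt.continuousWithinAt ?_
    refine (continuous_snd.continuousAt (x := (z, a))).add ?_
    refine ContinuousAt.congr (f := fun _ ↦ φ i z - φ j z) continuousAt_const ?_
    filter_upwards [continuous_fst.continuousAt.eventually
      (hφ.eventually_sub_eq i j z hz)] with p hp using hp.symm
  coordChange_comp i j k x _ a := by abel

/-- With the discrete topology on `A`, the bundle `potentialCore` is a covering of `X`, so `g` lifts
to it. The fibre coordinate of the lift yields the primitive. -/
theorem exists_isPrimitiveAlong [SimplyConnectedSpace Y] [LocallyPathConnectedSpace Y]
    (hφ : IsLocalPotential U φ) (g : C(Y, X)) : ∃ u : Y → A, IsPrimitiveAlong U φ g u := by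
  let _ : TopologicalSpace A := ⊥
  have : DiscreteTopology A := ⟨rfl⟩
  let Z := potentialCore hφ
  have hcov : IsCoveringMap (π A Z.Fiber) := FiberBundle.isCoveringMap
  obtain ⟨y₀⟩ : Nonempty Y := inferInstance
  obtain ⟨G, ⟨-, hG⟩, -⟩ := hcov.existsUnique_continuousMap_lifts g y₀
    (⟨g y₀, (0 : A)⟩ : TotalSpace A Z.Fiber) rfl
  have hG' : ∀ y, (G y).proj = g y := fun y ↦ congrFun hG y
  let a : Y → A := fun y ↦ (G y).2
  -- The coordinate `a y` is taken in the chart indexed by the base point `g y` itself. Passing to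
  -- the fixed chart `x` adds `φ (g y) (g y) - φ x (g y)`, and the coordinate there is locally
  -- constant because the fibre is discrete.
  refine ⟨fun y ↦ a y + φ (g y) (g y), fun x y hy ↦ ?_⟩
  have hc : ContinuousAt (fun z ↦ (Z.localTriv x (G z)).2) y := by
    have h1 : ContinuousAt (Z.localTriv x) (G y) := by
      refine (Z.localTriv x).continuousAt ?_
      rw [(Z.localTriv x).mem_source]
      change (G y).proj ∈ U x
      rwa [hG']
    exact (h1.comp G.continuous.continuousAt).snd
  have hd := hc.eventually (mem_nhds_discrete.2 (mem_singleton _))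
  filter_upwards [hd] with z hz
  have e : ∀ z, (Z.localTriv x (G z)).2 = a z + (φ (g z) (g z) - φ x (g z)) := by
    intro z
    rw [← hG' z]
    rfl
  have hz' : (Z.localTriv x (G z)).2 = (Z.localTriv x (G y)).2 := hz
  rw [e, e] at hz'
  rw [add_sub_assoc, add_sub_assoc, hz']

instance (k : ℕ) : ContractibleSpace (stdSimplex ℝ (Fin (k + 1))) :=
  (convex_stdSimplex ℝ _).contractibleSpace ⟨_, (stdSimplex.vertex 0).2⟩

instance (k : ℕ) : LocallyPathConnectedSpace (stdSimplex ℝ (Fin (k + 1))) :=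
  (convex_stdSimplex ℝ _).locallyPathConnectedSpace

/-- Local potentials define a singular `1`-cocycle, by integration along paths. -/
theorem exists_cocycle_of_isLocalPotential (hφ : IsLocalPotential U φ) :
    ∃ f : cocycles₁ X A, ∀ σ : Simplex X 1, ∃ u : ℝ → A,
      IsPrimitiveAlong U φ (path σ) u ∧ f.1 σ = u 1 - u 0 := by
  choose u hu using fun (k : ℕ) (σ : Simplex X k) ↦ exists_isPrimitiveAlong hφ σ
  let f : Cochain X A 1 := fun σ ↦ u 1 σ (stdSimplex.vertex 1) - u 1 σ (stdSimplex.vertex 0)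
  have hf : f ∈ cocycles₁ X A := by
    rw [AddMonoidHom.mem_ker]
    funext τ
    -- The primitive on `τ` restricts to a primitive on each face, so by uniqueness it computes the
    -- value of `f` there; the alternating sum then cancels at the vertices.
    have hface : ∀ i : Fin 3, f (τ.face i) = u 2 τ (stdSimplex.vertex (i.succAbove 1))
        - u 2 τ (stdSimplex.vertex (i.succAbove 0)) := by
      intro i
      have h := (hu 2 τ).comp (stdSimplex.continuous_map (S := ℝ) i.succAbove)
      have := (hu 1 (τ.face i)).sub_eq hφ h (stdSimplex.vertex 1) (stdSimplex.vertex 0)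
      simpa using this
    change ∑ i : Fin 3, (-1 : ℤ) ^ (i : ℕ) • f (τ.face i) = 0
    simp only [hface, Fin.sum_univ_three]
    have e00 : (0 : Fin 3).succAbove (0 : Fin 2) = 1 := rfl
    have e01 : (0 : Fin 3).succAbove (1 : Fin 2) = 2 := rfl
    have e10 : (1 : Fin 3).succAbove (0 : Fin 2) = 0 := rfl
    have e11 : (1 : Fin 3).succAbove (1 : Fin 2) = 2 := rfl
    have e20 : (2 : Fin 3).succAbove (0 : Fin 2) = 0 := rfl
    have e21 : (2 : Fin 3).succAbove (1 : Fin 2) = 1 := rfl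
    simp [e00, e01, e10, e11, e20, e21]
  refine ⟨⟨f, hf⟩, fun σ ↦ ?_⟩
  have hp : Continuous fun t : ℝ ↦
      stdSimplexHomeomorphUnitInterval.symm (projIcc (0 : ℝ) 1 zero_le_one t) :=
    stdSimplexHomeomorphUnitInterval.symm.continuous.comp continuous_projIcc
  refine ⟨_, (hu 1 σ).comp hp, ?_⟩
  have h0 : stdSimplexHomeomorphUnitInterval.symm (projIcc (0 : ℝ) 1 zero_le_one 0)
      = stdSimplex.vertex 0 := by
    rw [Homeomorph.symm_apply_eq, projIcc_left]; exact stdSimplexHomeomorphUnitInterval_zero.symm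
  have h1 : stdSimplexHomeomorphUnitInterval.symm (projIcc (0 : ℝ) 1 zero_le_one 1)
      = stdSimplex.vertex 1 := by
    rw [Homeomorph.symm_apply_eq, projIcc_right]; exact stdSimplexHomeomorphUnitInterval_one.symm
  simp only [Function.comp_apply, h0, h1]
  rfl

end Potentials

/-! ### Smooth paths determine a cocycle -/

section SmoothPaths

variable {n : ℕ} {X : Type*} [TopologicalSpace X] [ChartedSpace (EuclideanSpace ℝ (Fin n)) X]
  [IsManifold (𝓡 n) ∞ X] {A : Type*} [AddCommGroup A]

/-- A singular cocycle that vanishes on all smooth paths is zero. -/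
theorem cocycle_eq_zero_of_smooth (f : cocycles₁ X A)
    (hf : ∀ σ : Simplex X 1, IsSmoothPath (n := n) σ → f.1 σ = 0) : f = 0 := by
  refine cocycle_eq_zero_of_locally f fun x ↦ ?_
  let c := chartAt (EuclideanSpace ℝ (Fin n)) x
  obtain ⟨δ, hδ, hball⟩ := Metric.isOpen_iff.1 c.open_target (c x) (mem_chart_target _ x)
  let B := Metric.ball (c x) δ
  refine ⟨c.source ∩ c ⁻¹' B,
    (c.continuousOn.isOpen_inter_preimage c.open_source Metric.isOpen_ball).mem_nhds
      ⟨mem_chart_source _ x, Metric.mem_ball_self hδ⟩, fun σ hσ ↦ ?_⟩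
  have hσ' : ∀ t, path σ t ∈ c.source ∩ c ⁻¹' B := by
    intro t
    rcases le_total t 0 with h | h
    · rw [path_of_le_zero σ h]; exact hσ 0 (by simp)
    · rcases le_total t 1 with h' | h'
      · exact hσ t ⟨h, h'⟩
      · rw [path_of_one_le σ h']; exact hσ 1 (by simp)
  have hcc : Continuous fun t ↦ c (path σ t) :=
    c.continuousOn.comp_continuous (continuous_path σ) fun t ↦ (hσ' t).1
  -- Clamping the parameters to `[0, 1]` keeps the homotopy inside the convex ball while it is
  -- defined on all of `ℝ × ℝ`.
  let cl : ℝ → ℝ := fun t ↦ projIcc (0 : ℝ) 1 zero_le_one t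
  have hcl : Continuous cl := continuous_subtype_val.comp continuous_projIcc
  have hclI : ∀ t, cl t ∈ Icc (0 : ℝ) 1 := fun t ↦ (projIcc (0 : ℝ) 1 zero_le_one t).2
  have hcl' : ∀ t ∈ Icc (0 : ℝ) 1, cl t = t := fun t ht ↦ by simp [cl, projIcc_of_mem _ ht]
  let L : ℝ → EuclideanSpace ℝ (Fin n) := fun t ↦
    (1 - t) • c (path σ 0) + t • c (path σ 1)
  have hLB : ∀ t ∈ Icc (0 : ℝ) 1, L t ∈ B := fun t ht ↦
    (convex_ball _ δ) (hσ' 0).2 (hσ' 1).2 (by linarith [ht.2]) ht.1 (by ring)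
  -- In the chart, the straight-line homotopy from the path to the chord `L` between its endpoints,
  -- which stay fixed.
  let K : ℝ × ℝ → EuclideanSpace ℝ (Fin n) := fun p ↦
    (1 - cl p.2) • c (path σ p.1) + cl p.2 • L (cl p.1)
  have hKB : ∀ p, K p ∈ B := fun p ↦
    (convex_ball _ δ) (hσ' p.1).2 (hLB _ (hclI _)) (by linarith [(hclI p.2).2]) (hclI p.2).1
      (by ring)
  have hKc : Continuous K := by
    have hL : Continuous L := by fun_prop
    have := hL.comp (hcl.comp continuous_fst : Continuous fun p : ℝ × ℝ ↦ cl p.1)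
    have h2 := hcl.comp continuous_snd (X := ℝ × ℝ)
    have h3 := hcc.comp continuous_fst (X := ℝ × ℝ)
    exact ((continuous_const.sub h2).smul h3).add (h2.smul this)
  let H : C(ℝ × ℝ, X) := ⟨fun p ↦ c.symm (K p),
    c.symm.continuousOn.comp_continuous hKc fun p ↦ hball (hKB p)⟩
  have hbot : segmentSimplex H (0, 0) (1, 0) = σ := by
    refine simplex_ext fun t ht ↦ ?_
    rw [path_segmentSimplex _ _ _ ht]
    simp [H, K, hcl' 0, c.left_inv (hσ' t).1]
  have htop : IsSmoothPath (n := n) (segmentSimplex H (0, 1) (1, 1)) := by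
    have h1 : ContMDiffOn 𝓘(ℝ, ℝ) (𝓡 n) ∞ (fun t ↦ c.symm (L t)) (Icc 0 1) := by
      refine (contMDiffOn_chart_symm (x := x)).comp (t := c.target) ?_ fun t ht ↦ hball (hLB t ht)
      have hL : ContDiff ℝ ∞ L := by fun_prop
      exact hL.contMDiff.contMDiffOn
    refine h1.congr fun t ht ↦ ?_
    rw [path_segmentSimplex _ _ _ ht]
    simp [H, K, hcl' 1, hcl' t ht]
  have h := cocycle_eq_of_homotopy f H
    (fun s hs ↦ by
      simp only [H, K, L, ContinuousMap.coe_mk, hcl' 0 (by simp), hcl' s hs]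
      congr 1; module)
    (fun s hs ↦ by
      simp only [H, K, L, ContinuousMap.coe_mk, hcl' 0 (by simp), hcl' 1 (by simp), hcl' s hs]
      congr 1; module)
  rw [hbot, hf _ htop] at h
  exact h

/-- Two singular cocycles that agree on all smooth paths are equal. -/
theorem cocycle_ext_of_smooth {f f' : cocycles₁ X A}
    (h : ∀ σ : Simplex X 1, IsSmoothPath (n := n) σ → f.1 σ = f'.1 σ) : f = f' := by
  rw [← sub_eq_zero]
  refine cocycle_eq_zero_of_smooth (n := n) _ fun σ hσ ↦ ?_
  simp [h σ hσ]

end SmoothPaths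

/-! ### Smooth sections, coordinate vector fields and quotients of sections -/

section Sections

variable {n : ℕ} {X : Type*} [TopologicalSpace X] [ChartedSpace (EuclideanSpace ℝ (Fin n)) X]

/-- Multiplication by a bump function. It turns local fields and frames into global ones, as
required by `IsFlat` and `IsParallelAlong`, which speak of global smooth sections. -/
theorem exists_contMDiff_section_eventuallyEq [T2Space X] [IsManifold (𝓡 n) ∞ X]
    {F : Type*} [NormedAddCommGroup F] [NormedSpace ℝ F]
    {V : X → Type*} [TopologicalSpace (TotalSpace F V)] [∀ x, AddCommGroup (V x)]
    [∀ x, Module ℝ (V x)] [∀ x, TopologicalSpace (V x)] [FiberBundle F V] [VectorBundle ℝ F V]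
    {u : Set X} (hu : IsOpen u) {x : X} (hx : x ∈ u) {s : Π y : X, V y}
    (hs : ContMDiffOn (𝓡 n) ((𝓡 n).prod 𝓘(ℝ, F)) ∞ (fun y ↦ TotalSpace.mk' F y (s y)) u) :
    ∃ s' : Π y : X, V y,
      ContMDiff (𝓡 n) ((𝓡 n).prod 𝓘(ℝ, F)) ∞ (fun y ↦ TotalSpace.mk' F y (s' y)) ∧
      ∀ᶠ y in 𝓝 x, s' y = s y := by
  obtain ⟨f, -, hf⟩ := (SmoothBumpFunction.nhds_basis_tsupport (I := 𝓡 n) x).mem_iff.1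
    (hu.mem_nhds hx)
  refine ⟨(f : X → ℝ) • s, ContMDiffOn.smul_section_of_tsupport f.contMDiff.contMDiffOn hu hf hs, ?_⟩
  filter_upwards [f.eventuallyEq_one] with y hy
  simp [hy]

/-- The constant vector field on a Euclidean space. -/
def constField (v : EuclideanSpace ℝ (Fin n)) :
    Π z : EuclideanSpace ℝ (Fin n), TangentSpace 𝓘(ℝ, EuclideanSpace ℝ (Fin n)) z := fun _ ↦ v

theorem contMDiffAt_constField {k : WithTop ℕ∞} (v z : EuclideanSpace ℝ (Fin n)) :
    ContMDiffAt 𝓘(ℝ, EuclideanSpace ℝ (Fin n)) 𝓘(ℝ, EuclideanSpace ℝ (Fin n)).tangent k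
      (fun z ↦ (⟨z, constField v z⟩ : TangentBundle 𝓘(ℝ, EuclideanSpace ℝ (Fin n))
        (EuclideanSpace ℝ (Fin n)))) z :=
  contMDiffAt_vectorSpace_iff_contDiffAt.2 contDiffAt_const

theorem mlieBracket_constField (v w : EuclideanSpace ℝ (Fin n)) :
    VectorField.mlieBracket 𝓘(ℝ, EuclideanSpace ℝ (Fin n)) (constField v) (constField w) = 0 := by
  rw [← VectorField.mlieBracketWithin_univ, VectorField.mlieBracketWithin_eq_lieBracketWithin]
  funext z
  have h : ∀ u : EuclideanSpace ℝ (Fin n), fderivWithin ℝ (constField u) univ z = 0 := fun u ↦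
    fderivWithin_const_apply (𝕜 := ℝ) (E := EuclideanSpace ℝ (Fin n)) u
  change fderivWithin ℝ (constField w) univ z v - fderivWithin ℝ (constField v) univ z w = 0
  rw [h, h]
  exact sub_self _

/-- The vector field on the domain of the chart at `x` with constant coordinates `v`. -/
def coordField (x : X) (v : EuclideanSpace ℝ (Fin n)) : Π y : X, TangentSpace (𝓡 n) y :=
  VectorField.mpullback (𝓡 n) 𝓘(ℝ, EuclideanSpace ℝ (Fin n)) (extChartAt (𝓡 n) x) (constField v)

/-- The derivative at `y` of the chart at `x`. -/
def chartDeriv (x y : X) : TangentSpace (𝓡 n) y →L[ℝ] EuclideanSpace ℝ (Fin n) :=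
  mfderiv (𝓡 n) 𝓘(ℝ, EuclideanSpace ℝ (Fin n)) (extChartAt (𝓡 n) x) y

theorem chartDeriv_coordField [IsManifold (𝓡 n) ∞ X] {x y : X}
    (hy : y ∈ (extChartAt (𝓡 n) x).source) (v : EuclideanSpace ℝ (Fin n)) :
    chartDeriv x y (coordField x v y) = v :=
  (isInvertible_mfderiv_extChartAt (I := 𝓡 n) hy).self_apply_inverse _

theorem coordField_chartDeriv [IsManifold (𝓡 n) ∞ X] {x y : X}
    (hy : y ∈ (extChartAt (𝓡 n) x).source) (v : TangentSpace (𝓡 n) y) :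
    coordField x (chartDeriv x y v) y = v :=
  (isInvertible_mfderiv_extChartAt (I := 𝓡 n) hy).inverse_apply_self _

theorem contMDiffOn_coordField [IsManifold (𝓡 n) ∞ X] (x : X) (v : EuclideanSpace ℝ (Fin n)) :
    ContMDiffOn (𝓡 n) ((𝓡 n).prod 𝓘(ℝ, EuclideanSpace ℝ (Fin n))) ∞
      (fun y ↦ TotalSpace.mk' (EuclideanSpace ℝ (Fin n)) y (coordField x v y))
      (extChartAt (𝓡 n) x).source := by
  intro y hy
  refine ContMDiffAt.contMDiffWithinAt ?_
  exact ContMDiffAt.mpullback_vectorField_preimage (n := ∞) (contMDiffAt_constField v _)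
    (contMDiffAt_extChartAt' (by simpa using hy)) (isInvertible_mfderiv_extChartAt hy) (by simp)

/-- Pullback by the chart preserves brackets, and constant fields commute. This removes the bracket
term from the curvature. -/
theorem mlieBracket_coordField [IsManifold (𝓡 n) ∞ X] {x y : X}
    (hy : y ∈ (extChartAt (𝓡 n) x).source) (v w : EuclideanSpace ℝ (Fin n)) :
    VectorField.mlieBracket (𝓡 n) (coordField x v) (coordField x w) y = 0 := by
  have h2 : minSmoothness ℝ 2 ≤ (∞ : WithTop ℕ∞) := by
    rw [minSmoothness_of_isRCLikeNormedField]
    exact WithTop.coe_le_coe.2 le_top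
  have : IsManifold (𝓡 n) (minSmoothness ℝ 2) X := IsManifold.of_le h2
  have h := VectorField.mpullback_mlieBracket (n := ∞) (I := 𝓡 n)
    (I' := 𝓘(ℝ, EuclideanSpace ℝ (Fin n)))
    (f := extChartAt (𝓡 n) x) (x₀ := y) (V := constField v) (W := constField w)
    ((contMDiffAt_constField (k := 1) v _).mdifferentiableAt (by simp))
    ((contMDiffAt_constField (k := 1) w _).mdifferentiableAt (by simp))
    (contMDiffAt_extChartAt' (by simpa using hy)) h2
  rw [coordField, coordField, ← h, mlieBracket_constField, VectorField.mpullback_zero]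
  rfl

set_option linter.unusedSectionVars false

variable {l : X → Type*} [TopologicalSpace (TotalSpace ℝ l)]
  [∀ x, AddCommGroup (l x)] [∀ x, Module ℝ (l x)] [∀ x, TopologicalSpace (l x)]
  [∀ x, IsTopologicalAddGroup (l x)] [∀ x, ContinuousSMul ℝ (l x)]
  [FiberBundle ℝ l] [VectorBundle ℝ ℝ l]

/-- The quotient `v / e` of two vectors of a fibre, where `e ≠ 0`. -/
def fiberRatio {x : X} (e v : l x) : ℝ :=
  open Classical in if h : e ≠ 0 then (exists_smul_eq h v).choose else 0

theorem fiberRatio_smul {x : X} {e : l x} (he : e ≠ 0) (v : l x) : fiberRatio e v • e = v := by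
  rw [fiberRatio, dif_pos he]
  exact (exists_smul_eq he v).choose_spec.symm

theorem fiberRatio_eq_iff {x : X} {e v : l x} (he : e ≠ 0) {a : ℝ} :
    fiberRatio e v = a ↔ v = a • e := by
  constructor
  · rintro rfl
    exact (fiberRatio_smul he v).symm
  · intro h
    have := fiberRatio_smul he v
    rw [h] at this
    rw [h]
    exact smul_left_injective ℝ he this

theorem fiberRatio_ne_zero {x : X} {e v : l x} (he : e ≠ 0) (hv : v ≠ 0) :
    fiberRatio e v ≠ 0 := by
  intro h
  rw [fiberRatio_eq_iff he, zero_smul] at h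
  exact hv h

theorem trivialization_snd_ne_zero {x y : X} {v : l y} (hv : v ≠ 0)
    (hy : y ∈ (trivializationAt ℝ l x).baseSet) : (trivializationAt ℝ l x ⟨y, v⟩).2 ≠ 0 := by
  have := (((trivializationAt ℝ l x).continuousLinearEquivAt ℝ y hy).map_ne_zero_iff).2 hv
  simpa using this

theorem fiberRatio_eq_div {x y : X} {e v : l y} (he : e ≠ 0)
    (hy : y ∈ (trivializationAt ℝ l x).baseSet) :
    fiberRatio e v = (trivializationAt ℝ l x ⟨y, v⟩).2 / (trivializationAt ℝ l x ⟨y, e⟩).2 := by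
  have h0 := trivialization_snd_ne_zero (x := x) he hy
  rw [eq_div_iff h0]
  conv_rhs => rw [← fiberRatio_smul he v]
  exact (((trivializationAt ℝ l x).linear ℝ hy).2 (fiberRatio e v) e).symm

theorem eventually_ne_zero_of_continuousAt {s : Π y : X, l y} {x : X}
    (hs : ContinuousAt (fun y ↦ TotalSpace.mk' ℝ y (s y)) x) (hx : s x ≠ 0) :
    ∀ᶠ y in 𝓝 x, s y ≠ 0 := by
  have hb := FiberBundle.mem_baseSet_trivializationAt' (F := ℝ) (E := l) x
  have h1 : ContinuousAt (fun y ↦ (trivializationAt ℝ l x ⟨y, s y⟩).2) x :=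
    (((trivializationAt ℝ l x).continuousAt (x := ⟨x, s x⟩)
      ((trivializationAt ℝ l x).mem_source.2 hb)).comp (f := fun y ↦ TotalSpace.mk' ℝ y (s y))
        hs).snd
  have h2 := h1.eventually_ne (trivialization_snd_ne_zero hx hb)
  filter_upwards [h2, (trivializationAt ℝ l x).open_baseSet.mem_nhds hb] with y hy hyb h0
  apply hy
  rw [h0]
  simpa using (((trivializationAt ℝ l x).linear ℝ hyb).2 0 (0 : l y))

theorem contMDiffAt_fiberRatio {k : WithTop ℕ∞} [ContMDiffVectorBundle k ℝ l (𝓡 n)]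
    {e s : Π y : X, l y} {x : X}
    (he : ContMDiffAt (𝓡 n) ((𝓡 n).prod 𝓘(ℝ, ℝ)) k (fun y ↦ TotalSpace.mk' ℝ y (e y)) x)
    (hs : ContMDiffAt (𝓡 n) ((𝓡 n).prod 𝓘(ℝ, ℝ)) k (fun y ↦ TotalSpace.mk' ℝ y (s y)) x)
    (h0 : e x ≠ 0) :
    ContMDiffAt (𝓡 n) 𝓘(ℝ, ℝ) k (fun y ↦ fiberRatio (e y) (s y)) x := by
  have hb := FiberBundle.mem_baseSet_trivializationAt' (F := ℝ) (E := l) x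
  have hne := eventually_ne_zero_of_continuousAt he.continuousAt h0
  rw [contMDiffAt_section] at he hs
  refine (hs.div₀ he (trivialization_snd_ne_zero h0 hb)).congr_of_eventuallyEq ?_
  filter_upwards [hne, (trivializationAt ℝ l x).open_baseSet.mem_nhds hb] with y hy hyb
  exact fiberRatio_eq_div hy hyb

theorem IsSmoothSection.eventually_ne_zero {s : Π y : X, l y} (hs : IsSmoothSection (n := n) s)
    {x : X} (hx : s x ≠ 0) : ∀ᶠ y in 𝓝 x, s y ≠ 0 :=
  eventually_ne_zero_of_continuousAt hs.continuous.continuousAt hx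

variable [ContMDiffVectorBundle ∞ ℝ l (𝓡 n)]

theorem IsSmoothSection.isDiffSectionAt {s : Π y : X, l y} (hs : IsSmoothSection (n := n) s)
    (x : X) : IsDiffSectionAt (n := n) s x :=
  (hs x).mdifferentiableAt (by simp)

theorem IsSmoothSection.contMDiffAt_fiberRatio {e s : Π y : X, l y}
    (he : IsSmoothSection (n := n) e) (hs : IsSmoothSection (n := n) s) {x : X} (h0 : e x ≠ 0) :
    ContMDiffAt (𝓡 n) 𝓘(ℝ, ℝ) ∞ (fun y ↦ fiberRatio (e y) (s y)) x :=
  RealLineBundle.contMDiffAt_fiberRatio (he x) (hs x) h0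

/-- A connection applied to a multiple of a section. -/
theorem covariantDerivative_of_eventuallyEq_smul (D : CovariantDerivative (𝓡 n) ℝ l)
    {s e : Π y : X, l y} {q : X → ℝ} {x : X} (he : IsDiffSectionAt (n := n) e x)
    (hq : MDifferentiableAt (𝓡 n) 𝓘(ℝ, ℝ) q x) (h : ∀ᶠ y in 𝓝 x, s y = q y • e y)
    (V : TangentSpace (𝓡 n) x) :
    D s x V = q x • D e x V + mvfderiv (𝓡 n) q x V • e x := by
  have hd : IsDiffSectionAt (n := n) (q • e) x := hq.smul_section he
  have hs : IsDiffSectionAt (n := n) s x := by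
    refine hd.congr_of_eventuallyEq ?_
    filter_upwards [h] with y hy
    rw [hy]; rfl
  have h1 : D s x = D (q • e) x :=
    (D.isCovariantDerivativeOn (s := univ)).congr_of_eventuallyEq hs hd Filter.univ_mem h
  rw [h1, D.isCovariantDerivativeOnUniv.leibniz he hq]
  rfl

/-- Near each point there is a smooth frame that extends to a smooth section. -/
theorem exists_smooth_frame [T2Space X] [IsManifold (𝓡 n) ∞ X] (x : X) :
    ∃ e : Π y : X, l y, IsSmoothSection (n := n) e ∧ e x ≠ 0 := by
  let L := (trivializationAt ℝ l x).continuousLinearEquivAt ℝ x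
      (FiberBundle.mem_baseSet_trivializationAt' x)
  obtain ⟨u, hu, hs⟩ := FiberBundle.exists_contMDiffOn_extend (k := ∞) (𝓡 n) ℝ (L.symm 1)
  obtain ⟨o, hou, ho, hxo⟩ := mem_nhds_iff.1 hu
  obtain ⟨e, he, hes⟩ := exists_contMDiff_section_eventuallyEq ho hxo (hs.mono hou)
  refine ⟨e, he, ?_⟩
  rw [hes.self_of_nhds, FiberBundle.extend_apply_self]
  simp

end Sections

/-! ### Local flat frames from vanishing curvature -/

section FlatFrames

set_option linter.unusedSectionVars false

variable {n : ℕ} {X : Type*} [TopologicalSpace X] [ChartedSpace (EuclideanSpace ℝ (Fin n)) X]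
  [IsManifold (𝓡 n) ∞ X]

theorem coordField_eq_sum (x y : X) (v : EuclideanSpace ℝ (Fin n)) :
    coordField x v y = ∑ i, v i • coordField x (EuclideanSpace.single i (1 : ℝ)) y := by
  let L : EuclideanSpace ℝ (Fin n) →L[ℝ] TangentSpace (𝓡 n) y :=
    (mfderiv (𝓡 n) 𝓘(ℝ, EuclideanSpace ℝ (Fin n)) (extChartAt (𝓡 n) x) y).inverse
  have hv : v = ∑ i, v i • EuclideanSpace.single i (1 : ℝ) := by
    ext j
    simp [Finset.sum_apply, Pi.single_apply]
  have h : L v = ∑ i, v i • L (EuclideanSpace.single i (1 : ℝ)) := by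
    conv_lhs => rw [hv]
    simp only [map_sum, map_smul]
  exact h

theorem mvfderiv_comp_extChartAt {x y : X} (hy : y ∈ (extChartAt (𝓡 n) x).source)
    {g : EuclideanSpace ℝ (Fin n) → ℝ} {g' : EuclideanSpace ℝ (Fin n) →L[ℝ] ℝ}
    (hg : HasFDerivAt g g' (extChartAt (𝓡 n) x y)) (W : TangentSpace (𝓡 n) y) :
    mvfderiv (𝓡 n) (g ∘ extChartAt (𝓡 n) x) y W
      = g' (chartDeriv x y W) := by
  have hc : MDifferentiableAt (𝓡 n) 𝓘(ℝ, EuclideanSpace ℝ (Fin n)) (extChartAt (𝓡 n) x) y :=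
    mdifferentiableAt_extChartAt (by simpa using hy)
  have h := (hg.hasMFDerivAt.comp y hc.hasMFDerivAt).mfderiv
  rw [mvfderiv, h]
  rfl

/-- The differential of a real function depends only on its germ. -/
theorem mvfderiv_congr {f g : X → ℝ} {x : X} (h : f =ᶠ[𝓝 x] g) :
    mvfderiv (𝓡 n) f x = mvfderiv (𝓡 n) g x := by
  simp only [mvfderiv, h.mfderiv_eq]
  rw [h.eq_of_nhds]

theorem fderiv_comp_extChartAt_symm {x y : X} (hy : y ∈ (extChartAt (𝓡 n) x).source) {q : X → ℝ}
    (hq : DifferentiableAt ℝ (q ∘ (extChartAt (𝓡 n) x).symm) (extChartAt (𝓡 n) x y))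
    (v : EuclideanSpace ℝ (Fin n)) :
    fderiv ℝ (q ∘ (extChartAt (𝓡 n) x).symm) (extChartAt (𝓡 n) x y) v
      = mvfderiv (𝓡 n) q y (coordField x v y) := by
  have h := mvfderiv_comp_extChartAt hy hq.hasFDerivAt (coordField x v y)
  rw [chartDeriv_coordField hy] at h
  rw [← h]
  refine congrArg (fun L : TangentSpace (𝓡 n) y →L[ℝ] ℝ ↦ L (coordField x v y)) ?_
  refine mvfderiv_congr ?_
  filter_upwards [extChartAt_source_mem_nhds' hy] with z hz
  simp only [Function.comp_apply, (extChartAt (𝓡 n) x).left_inv hz]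

variable {l : X → Type*} [TopologicalSpace (TotalSpace ℝ l)]
  [∀ x, AddCommGroup (l x)] [∀ x, Module ℝ (l x)] [∀ x, TopologicalSpace (l x)]
  [∀ x, IsTopologicalAddGroup (l x)] [∀ x, ContinuousSMul ℝ (l x)]
  [FiberBundle ℝ l] [VectorBundle ℝ ℝ l] [ContMDiffVectorBundle ∞ ℝ l (𝓡 n)]

theorem IsSmoothSection.covariantDerivative (D : CovariantDerivative (𝓡 n) ℝ l)
    [hD : D.ContMDiffCovariantDerivative ∞] {e : Π x : X, l x} (he : IsSmoothSection (n := n) e)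
    {V : Π x : X, TangentSpace (𝓡 n) x} (hV : IsSmoothField V) :
    IsSmoothSection (n := n) fun y ↦ D e y (V y) := by
  have h := hD.contMDiff.contMDiff (σ := e) (by
    have : ((∞ : WithTop ℕ∞) + 1) = ∞ := rfl
    rw [this]
    exact ContMDiff.contMDiffOn he)
  rw [contMDiffOn_univ] at h
  exact h.clm_bundle_apply hV

/-- A flat connection on a line bundle has a flat frame near each point. -/
theorem exists_flat_frame [T2Space X] (D : CovariantDerivative (𝓡 n) ℝ l)
    [D.ContMDiffCovariantDerivative ∞] (hD : IsFlat D) (x : X) :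
    ∃ e : Π y : X, l y, IsSmoothSection (n := n) e ∧ e x ≠ 0 ∧ ∀ᶠ y in 𝓝 x, D e y = 0 := by
  let c := extChartAt (𝓡 n) x
  obtain ⟨e₀, he₀, he₀x⟩ := exists_smooth_frame (n := n) (l := l) x
  have hV : ∀ i : Fin n, ∃ V : Π y : X, TangentSpace (𝓡 n) y, IsSmoothField V ∧
      ∀ᶠ y in 𝓝 x, V y = coordField x (EuclideanSpace.single i (1 : ℝ)) y := fun i ↦
    exists_contMDiff_section_eventuallyEq (isOpen_extChartAt_source x) (mem_extChartAt_source x)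
      (contMDiffOn_coordField x _)
  choose V hVs hVc using hV
  -- The connection coefficients in the frame `e₀`: `D e₀ = a i • e₀` in the direction `V i`.
  let a : Fin n → X → ℝ := fun i y ↦ fiberRatio (e₀ y) (D e₀ y (V i y))
  have ha : ∀ i y, e₀ y ≠ 0 → D e₀ y (V i y) = a i y • e₀ y := fun i y hy ↦
    (fiberRatio_smul hy _).symm
  have has : ∀ i y, e₀ y ≠ 0 → ContMDiffAt (𝓡 n) 𝓘(ℝ, ℝ) ∞ (a i) y := fun i y hy ↦
    he₀.contMDiffAt_fiberRatio (he₀.covariantDerivative D (hVs i)) hy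
  have hN : ∀ᶠ y in 𝓝 x, y ∈ c.source ∧ (∀ᶠ z in 𝓝 y, e₀ z ≠ 0) ∧
      ∀ i, ∀ᶠ z in 𝓝 y, V i z = coordField x (EuclideanSpace.single i (1 : ℝ)) z := by
    have h0 : ∀ᶠ y in 𝓝 x, y ∈ c.source := extChartAt_source_mem_nhds x
    refine h0.and ((eventually_eventually_nhds.2 (he₀.eventually_ne_zero he₀x)).and ?_)
    exact Filter.eventually_all.2 fun i ↦ eventually_eventually_nhds.2 (hVc i)
  -- In rank one the quadratic terms `a i * a j` of the curvature cancel, leaving only the symmetry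
  -- of first derivatives, that is, closedness of the connection form.
  have hcurv : ∀ i j y, y ∈ c.source → (∀ᶠ z in 𝓝 y, e₀ z ≠ 0) →
      (∀ i, ∀ᶠ z in 𝓝 y, V i z = coordField x (EuclideanSpace.single i (1 : ℝ)) z) →
      mvfderiv (𝓡 n) (a i) y (V j y) = mvfderiv (𝓡 n) (a j) y (V i y) := by
    intro i j y hy hey hVy
    have hcov : ∀ i j, D (fun z ↦ D e₀ z (V i z)) y (V j y)
        = a i y • D e₀ y (V j y) + mvfderiv (𝓡 n) (a i) y (V j y) • e₀ y := by
      intro i j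
      refine covariantDerivative_of_eventuallyEq_smul D (he₀.isDiffSectionAt y)
        ((has i y hey.self_of_nhds).mdifferentiableAt (by simp)) ?_ _
      filter_upwards [hey] with z hz using ha i z hz
    have hb : VectorField.mlieBracket (𝓡 n) (V j) (V i) y = 0 := by
      rw [← mlieBracket_coordField hy (EuclideanSpace.single j (1 : ℝ))
        (EuclideanSpace.single i (1 : ℝ))]
      exact Filter.EventuallyEq.mlieBracket_vectorField_eq (hVy j) (hVy i)
    have h := hD (V j) (V i) e₀ (hVs j) (hVs i) he₀ y
    rw [hb, map_zero, sub_zero, hcov, hcov, ha i y hey.self_of_nhds, ha j y hey.self_of_nhds,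
      smul_smul, smul_smul, mul_comm (a j y), add_sub_add_left_eq_sub, ← sub_smul,
      smul_eq_zero_iff_left hey.self_of_nhds, sub_eq_zero] at h
    exact h
  obtain ⟨δ, hδ, hB⟩ : ∃ δ > 0, ∀ z ∈ Metric.ball (c x) δ, z ∈ c.target ∧
      (c.symm z ∈ c.source ∧ (∀ᶠ y in 𝓝 (c.symm z), e₀ y ≠ 0) ∧
      ∀ i, ∀ᶠ y in 𝓝 (c.symm z), V i y = coordField x (EuclideanSpace.single i (1 : ℝ)) y) := by
    have h1 : ∀ᶠ z in 𝓝 (c x), z ∈ c.target := extChartAt_target_mem_nhds x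
    have h2 : Filter.Tendsto c.symm (𝓝 (c x)) (𝓝 x) := by
      have := continuousAt_extChartAt_symm (I := 𝓡 n) x
      rwa [ContinuousAt, extChartAt_to_inv] at this
    exact Metric.eventually_nhds_iff_ball.1 (h1.and (h2.eventually hN))
  let B := Metric.ball (c x) δ
  let b : Fin n → EuclideanSpace ℝ (Fin n) → ℝ := fun i ↦ a i ∘ c.symm
  have hbs : ∀ i, ContDiffOn ℝ ∞ (b i) B := by
    intro i z hz
    obtain ⟨hzt, hys, hey, -⟩ := hB z hz
    have h1 : ContMDiffAt 𝓘(ℝ, EuclideanSpace ℝ (Fin n)) (𝓡 n) ∞ c.symm z :=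
      (contMDiffOn_extChartAt_symm x).contMDiffAt (extChartAt_target_mem_nhds' hzt)
    exact ((has i _ hey.self_of_nhds).comp z h1).contDiffAt.contDiffWithinAt
  have hbd : ∀ i, ∀ z ∈ B, DifferentiableAt ℝ (b i) z := fun i z hz ↦
    ((hbs i).contDiffAt (Metric.isOpen_ball.mem_nhds hz)).differentiableAt (by simp)
  let Ω : EuclideanSpace ℝ (Fin n) → EuclideanSpace ℝ (Fin n) →L[ℝ] ℝ := fun z ↦
    ∑ i, b i z • (EuclideanSpace.proj i : EuclideanSpace ℝ (Fin n) →L[ℝ] ℝ)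
  have hΩs : ContDiffOn ℝ ∞ Ω B :=
    ContDiffOn.sum fun i _ ↦ (hbs i).smul contDiffOn_const
  have hΩd : ∀ z ∈ B, ∀ v w, fderiv ℝ Ω z v w = ∑ i, fderiv ℝ (b i) z v * w i := by
    intro z hz v w
    have h : HasFDerivAt Ω (∑ i, (fderiv ℝ (b i) z).smulRight
        (EuclideanSpace.proj i : EuclideanSpace ℝ (Fin n) →L[ℝ] ℝ)) z :=
      HasFDerivAt.fun_sum fun i _ ↦
        (hbd i z hz).hasFDerivAt.smul_const (F := EuclideanSpace ℝ (Fin n) →L[ℝ] ℝ) (EuclideanSpace.proj i)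
    rw [h.fderiv]
    simp
  have hbsymm : ∀ z ∈ B, ∀ i j, fderiv ℝ (b i) z (EuclideanSpace.single j 1)
      = fderiv ℝ (b j) z (EuclideanSpace.single i 1) := by
    intro z hz i j
    obtain ⟨hzt, hys, hey, hVy⟩ := hB z hz
    have hcz : c (c.symm z) = z := c.right_inv hzt
    have key : ∀ i j, fderiv ℝ (b i) z (EuclideanSpace.single j 1)
        = mvfderiv (𝓡 n) (a i) (c.symm z) (V j (c.symm z)) := by
      intro i j
      rw [(hVy j).self_of_nhds, ← fderiv_comp_extChartAt_symm hys]
      · rw [hcz]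
      · rw [hcz]; exact hbd i z hz
    rw [key, key, hcurv i j _ hys hey hVy]
  have hdecomp : ∀ v : EuclideanSpace ℝ (Fin n), v = ∑ j, v j • EuclideanSpace.single j (1 : ℝ) := by
    intro v
    ext j
    simp [Finset.sum_apply, Pi.single_apply]
  have hΩsymm : ∀ z ∈ B, ∀ v w, fderiv ℝ Ω z v w = fderiv ℝ Ω z w v := by
    intro z hz v w
    have e1 : ∀ v w : EuclideanSpace ℝ (Fin n), fderiv ℝ Ω z v w =
        ∑ i, ∑ j, v j * w i * fderiv ℝ (b i) z (EuclideanSpace.single j 1) := by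
      intro v w
      rw [hΩd z hz]
      refine Finset.sum_congr rfl fun i _ ↦ ?_
      conv_lhs => rw [hdecomp v]
      simp only [map_sum, map_smul, smul_eq_mul, Finset.sum_mul]
      exact Finset.sum_congr rfl fun j _ ↦ by ring
    rw [e1, e1, Finset.sum_comm]
    refine Finset.sum_congr rfl fun i _ ↦ Finset.sum_congr rfl fun j _ ↦ ?_
    rw [hbsymm z hz j i]
    ring
  -- The Poincaré lemma on the ball, for the connection form `Ω` written in the chart.
  obtain ⟨g, hg⟩ := (convex_ball (c x) δ).exists_forall_hasFDerivAt_of_fderiv_symmetric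
    Metric.isOpen_ball (hΩs.differentiableOn (by simp)) hΩsymm
  have hgs : ContDiffOn ℝ ∞ g B := by
    rw [contDiffOn_infty_iff_fderiv_of_isOpen Metric.isOpen_ball]
    refine ⟨fun z hz ↦ (hg z hz).differentiableAt.differentiableWithinAt, hΩs.congr fun z hz ↦ ?_⟩
    exact (hg z hz).fderiv
  let u : Set X := c.source ∩ c ⁻¹' B
  have hu : IsOpen u := isOpen_extChartAt_preimage' x Metric.isOpen_ball
  have hxu : x ∈ u := ⟨mem_extChartAt_source x, Metric.mem_ball_self hδ⟩
  -- With `dg = Ω` one has `dq = -q Ω`, so the Leibniz rule gives `D (q e₀) = (dq + q Ω) e₀ = 0`.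
  let q : X → ℝ := (fun z ↦ Real.exp (-g z)) ∘ c
  have hqs : ContMDiffOn (𝓡 n) 𝓘(ℝ, ℝ) ∞ q u := by
    intro y hy
    have h1 : ContDiffAt ℝ ∞ (fun z ↦ Real.exp (-g z)) (c y) :=
      (hgs.contDiffAt (Metric.isOpen_ball.mem_nhds hy.2)).neg.exp
    exact (h1.contMDiffAt.comp y
      (contMDiffAt_extChartAt' (by simpa [c] using hy.1))).contMDiffWithinAt
  obtain ⟨e, he, heq⟩ := exists_contMDiff_section_eventuallyEq hu hxu
    (hqs.smul_section (s := e₀) (ContMDiff.contMDiffOn he₀))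
  refine ⟨e, he, ?_, ?_⟩
  · rw [heq.self_of_nhds]
    exact smul_ne_zero (Real.exp_ne_zero _) he₀x
  · filter_upwards [eventually_eventually_nhds.2 heq, hu.mem_nhds hxu] with y hy hyu
    obtain ⟨-, -, hey, hVy⟩ := hB (c y) hyu.2
    rw [c.left_inv hyu.1] at hey hVy
    ext W
    have hq := covariantDerivative_of_eventuallyEq_smul D (he₀.isDiffSectionAt y)
      ((hqs.contMDiffAt (hu.mem_nhds hyu)).mdifferentiableAt (by simp)) hy W
    rw [hq]
    have h1 : D e₀ y W = Ω (c y) (chartDeriv x y W) • e₀ y := by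
      conv_lhs => rw [← coordField_chartDeriv hyu.1 W, coordField_eq_sum]
      simp only [map_sum, map_smul, ← (hVy _).self_of_nhds, ha _ y hey.self_of_nhds]
      simp only [Ω, b, Function.comp_apply, c.left_inv hyu.1, _root_.sum_apply,
        _root_.smul_apply, Finset.sum_smul, smul_smul, smul_eq_mul]
      exact Finset.sum_congr rfl fun i _ ↦ by rw [mul_comm]; rfl
    have h2 : mvfderiv (𝓡 n) q y W
        = -(q y * Ω (c y) (chartDeriv x y W)) := by
      have h3 : HasFDerivAt (fun z ↦ Real.exp (-g z)) (Real.exp (-g (c y)) • -Ω (c y)) (c y) :=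
        (hg (c y) hyu.2).neg.exp
      rw [mvfderiv_comp_extChartAt hyu.1 h3]
      simp [q]
    rw [h1, h2, smul_smul, ← add_smul]
    simp

end FlatFrames

/-! ### Parallel transport in flat frames -/

/-- The real number underlying an element of `ℝˣ`, written additively. -/
def unitVal (a : Additive ℝˣ) : ℝ := ((a.toMul : ℝˣ) : ℝ)

theorem unitVal_ne_zero (a : Additive ℝˣ) : unitVal a ≠ 0 := a.toMul.ne_zero

theorem unitVal_add (a b : Additive ℝˣ) : unitVal (a + b) = unitVal a * unitVal b := rfl

theorem unitVal_sub (a b : Additive ℝˣ) : unitVal (a - b) = unitVal a / unitVal b :=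
  Units.val_div_eq_div_val _ _

theorem unitVal_injective : Function.Injective unitVal := fun _ _ h ↦
  Additive.toMul.injective (Units.ext h)

section Parallel

set_option linter.unusedSectionVars false

variable {n : ℕ} {X : Type*} [TopologicalSpace X] [ChartedSpace (EuclideanSpace ℝ (Fin n)) X]
  {l : X → Type*} [TopologicalSpace (TotalSpace ℝ l)]
  [∀ x, AddCommGroup (l x)] [∀ x, Module ℝ (l x)] [∀ x, TopologicalSpace (l x)]
  [∀ x, IsTopologicalAddGroup (l x)] [∀ x, ContinuousSMul ℝ (l x)]
  [FiberBundle ℝ l] [VectorBundle ℝ ℝ l]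

/-- The quotient of two nonzero vectors of a fibre as an element of `ℝˣ`, written additively. -/
def unitRatio {x : X} (e v : l x) : Additive ℝˣ :=
  open Classical in if h : fiberRatio e v ≠ 0 then Additive.ofMul (Units.mk0 _ h) else 0

theorem unitVal_unitRatio {x : X} {e v : l x} (he : e ≠ 0) (hv : v ≠ 0) :
    unitVal (unitRatio e v) = fiberRatio e v := by
  rw [unitRatio, dif_pos (fiberRatio_ne_zero he hv)]
  rfl

theorem unitRatio_smul {x : X} {e v : l x} (he : e ≠ 0) (hv : v ≠ 0) :
    unitVal (unitRatio e v) • e = v := by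
  rw [unitVal_unitRatio he hv, fiberRatio_smul he]

theorem unitRatio_sub_unitRatio {x : X} {e e' v : l x} (he : e ≠ 0) (he' : e' ≠ 0) (hv : v ≠ 0) :
    unitVal (unitRatio e v - unitRatio e' v) = fiberRatio e e' := by
  refine ((fiberRatio_eq_iff he).2 ?_).symm
  rw [unitVal_sub, unitVal_unitRatio he hv, unitVal_unitRatio he' hv, div_eq_inv_mul, mul_smul,
    fiberRatio_smul he]
  conv_rhs => rw [← fiberRatio_smul he' v]
  rw [smul_smul, fiberRatio_smul he', inv_mul_cancel₀ (fiberRatio_ne_zero he' hv), one_smul]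

/-- Smooth sections `e x` that are flat frames on open neighbourhoods `U x` of the points `x`. -/
structure IsFlatAtlas (D : CovariantDerivative (𝓡 n) ℝ l) (U : X → Set X)
    (e : X → Π y : X, l y) : Prop where
  isOpen : ∀ x, IsOpen (U x)
  mem : ∀ x, x ∈ U x
  smooth : ∀ x, IsSmoothSection (n := n) (e x)
  ne_zero : ∀ x, ∀ y ∈ U x, e x y ≠ 0
  flat : ∀ x, ∀ y ∈ U x, D (e x) y = 0

theorem eventually_eq_of_mvfderiv_eq_zero [IsManifold (𝓡 n) ∞ X] {q : X → ℝ} {x : X}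
    (hq : ∀ᶠ y in 𝓝 x, MDifferentiableAt (𝓡 n) 𝓘(ℝ, ℝ) q y ∧ mvfderiv (𝓡 n) q y = 0) :
    ∀ᶠ y in 𝓝 x, q y = q x := by
  let c := extChartAt (𝓡 n) x
  have h1 : ∀ᶠ z in 𝓝 (c x), z ∈ c.target := extChartAt_target_mem_nhds x
  have h2 : Filter.Tendsto c.symm (𝓝 (c x)) (𝓝 x) := by
    have := continuousAt_extChartAt_symm (I := 𝓡 n) x
    rwa [ContinuousAt, extChartAt_to_inv] at this
  obtain ⟨δ, hδ, hB⟩ := Metric.eventually_nhds_iff_ball.1 (h1.and (h2.eventually hq))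
  have hd : ∀ z ∈ Metric.ball (c x) δ, DifferentiableAt ℝ (q ∘ c.symm) z := by
    intro z hz
    have h3 : MDifferentiableAt 𝓘(ℝ, EuclideanSpace ℝ (Fin n)) (𝓡 n) c.symm z :=
      ((contMDiffOn_extChartAt_symm (n := ∞) x).contMDiffAt
        (extChartAt_target_mem_nhds' (hB z hz).1)).mdifferentiableAt (by simp)
    exact ((hB z hz).2.1.comp z h3).differentiableAt
  have hconst : ∀ z ∈ Metric.ball (c x) δ, (q ∘ c.symm) z = (q ∘ c.symm) (c x) := by
    intro z hz
    refine Metric.isOpen_ball.is_const_of_fderiv_eq_zero (𝕜 := ℝ) (convex_ball _ _).isPreconnected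
      (fun z hz ↦ (hd z hz).differentiableWithinAt) (fun z hz ↦ ?_) hz (Metric.mem_ball_self hδ)
    obtain ⟨hzt, -, hz0⟩ := hB z hz
    have hcz : c (c.symm z) = z := c.right_inv hzt
    ext v
    have := fderiv_comp_extChartAt_symm (x := x) (c.map_target hzt) (q := q)
      (by rw [show extChartAt (𝓡 n) x (c.symm z) = z from hcz]; exact hd z hz) v
    rw [show extChartAt (𝓡 n) x (c.symm z) = z from hcz, hz0] at this
    exact this
  have h3 : ∀ᶠ y in 𝓝 x, c y ∈ Metric.ball (c x) δ :=
    (continuousAt_extChartAt x).eventually (Metric.ball_mem_nhds _ hδ)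
  have h4 : ∀ᶠ y in 𝓝 x, y ∈ c.source := extChartAt_source_mem_nhds x
  filter_upwards [h3, h4] with y hy hys
  have := hconst _ hy
  simp only [Function.comp_apply] at this
  rwa [c.left_inv hys, c.left_inv (mem_extChartAt_source x)] at this

variable [ContMDiffVectorBundle ∞ ℝ l (𝓡 n)]

theorem exists_isFlatAtlas [T2Space X] [IsManifold (𝓡 n) ∞ X] (D : CovariantDerivative (𝓡 n) ℝ l)
    [D.ContMDiffCovariantDerivative ∞] (hD : IsFlat D) :
    ∃ (U : X → Set X) (e : X → Π y : X, l y), IsFlatAtlas D U e := by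
  choose e he he0 hef using fun x ↦ exists_flat_frame (n := n) (l := l) D hD x
  have hev : ∀ x, ∀ᶠ y in 𝓝 x, e x y ≠ 0 ∧ D (e x) y = 0 := fun x ↦
    ((he x).eventually_ne_zero (he0 x)).and (hef x)
  choose U hU hUo hxU using fun x ↦ eventually_nhds_iff.1 (hev x)
  exact ⟨U, e, hUo, hxU, he, fun x y hy ↦ (hU x y hy).1, fun x y hy ↦ (hU x y hy).2⟩

variable {D : CovariantDerivative (𝓡 n) ℝ l} {U : X → Set X} {e : X → Π y : X, l y}

/-- Writing one flat frame as `q` times the other, the Leibniz rule leaves `0 = dq • e x`, hence `dq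
= 0`. -/
theorem IsFlatAtlas.eventually_fiberRatio_eq [IsManifold (𝓡 n) ∞ X] (hU : IsFlatAtlas D U e)
    {x x' y : X} (hy : y ∈ U x) (hy' : y ∈ U x') :
    ∀ᶠ z in 𝓝 y, fiberRatio (e x z) (e x' z) = fiberRatio (e x y) (e x' y) := by
  refine eventually_eq_of_mvfderiv_eq_zero (n := n) (q := fun z ↦ fiberRatio (e x z) (e x' z)) ?_
  filter_upwards [(hU.isOpen x).mem_nhds hy, (hU.isOpen x').mem_nhds hy'] with z hz hz'
  have hd : MDifferentiableAt (𝓡 n) 𝓘(ℝ, ℝ) (fun z ↦ fiberRatio (e x z) (e x' z)) z :=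
    ((hU.smooth x).contMDiffAt_fiberRatio (hU.smooth x') (hU.ne_zero x z hz)).mdifferentiableAt
      (by simp)
  refine ⟨hd, ?_⟩
  ext W
  have h := covariantDerivative_of_eventuallyEq_smul D ((hU.smooth x).isDiffSectionAt z) hd
    (s := e x') (by
      filter_upwards [(hU.isOpen x).mem_nhds hz] with w hw
      exact (fiberRatio_smul (hU.ne_zero x w hw) _).symm) W
  rw [hU.flat x z hz, hU.flat x' z hz'] at h
  simp only [_root_.zero_apply, smul_zero, zero_add] at h
  exact (smul_eq_zero_iff_left (hU.ne_zero x z hz)).1 h.symm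

/-- In the difference of two potentials the vector `v` cancels, leaving a quotient of flat frames.
This is why `v` may be discontinuous. -/
theorem IsFlatAtlas.isLocalPotential [IsManifold (𝓡 n) ∞ X] (hU : IsFlatAtlas D U e)
    {v : Π x : X, l x} (hv : ∀ x, v x ≠ 0) :
    IsLocalPotential U fun x y ↦ unitRatio (e x y) (v y) where
  isOpen := hU.isOpen
  mem := hU.mem
  eventually_sub_eq x x' y hy := by
    filter_upwards [hU.eventually_fiberRatio_eq hy.1 hy.2, (hU.isOpen x).mem_nhds hy.1,
      (hU.isOpen x').mem_nhds hy.2] with z hz hzx hzx'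
    apply unitVal_injective
    rw [unitRatio_sub_unitRatio (hU.ne_zero x z hzx) (hU.ne_zero x' z hzx') (hv z), hz,
      unitRatio_sub_unitRatio (hU.ne_zero x y hy.1) (hU.ne_zero x' y hy.2) (hv y)]

/-- A section along `g` which is locally a constant multiple of a flat frame, for a primitive `u`
of the quotients of `v` by the flat frames. -/
def flatSection {Y : Type*} (v : Π x : X, l x) (g : Y → X) (u : Y → Additive ℝˣ) (t : Y) :
    l (g t) := (unitVal (u t))⁻¹ • v (g t)

variable {v : Π x : X, l x} {Y : Type*} [TopologicalSpace Y] {g : Y → X} {u : Y → Additive ℝˣ}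

theorem flatSection_ne_zero (hv : ∀ x, v x ≠ 0) (t : Y) : flatSection v g u t ≠ 0 :=
  smul_ne_zero (inv_ne_zero (unitVal_ne_zero _)) (hv _)

/-- Since `u` and `v / e x` differ by a constant factor near `t`, dividing `v` by `u` gives a
constant multiple of `e x`. -/
theorem IsFlatAtlas.eventually_flatSection_eq (hU : IsFlatAtlas D U e) (hv : ∀ x, v x ≠ 0)
    (hg : Continuous g) (hu : IsPrimitiveAlong U (fun x y ↦ unitRatio (e x y) (v y)) g u)
    {x : X} {t : Y} (ht : g t ∈ U x) :
    ∃ k : ℝ, k ≠ 0 ∧ ∀ᶠ r in 𝓝 t, flatSection v g u r = k • e x (g r) := by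
  refine ⟨(unitVal (u t - unitRatio (e x (g t)) (v (g t))))⁻¹,
    inv_ne_zero (unitVal_ne_zero _), ?_⟩
  filter_upwards [hu x t ht, hg.continuousAt.eventually ((hU.isOpen x).mem_nhds ht)] with r hr hrU
  have he := hU.ne_zero x _ hrU
  rw [← hr, unitVal_sub, unitVal_unitRatio he (hv _), flatSection, inv_div, div_eq_inv_mul,
    mul_smul, fiberRatio_smul he]

theorem IsFlatAtlas.isParallelAlong (hU : IsFlatAtlas D U e) (hv : ∀ x, v x ≠ 0)
    {σ : Simplex X 1} {u : ℝ → Additive ℝˣ}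
    (hu : IsPrimitiveAlong U (fun x y ↦ unitRatio (e x y) (v y)) (path σ) u) (a : ℝ) :
    IsParallelAlong D σ fun t ↦ a • flatSection v (path σ) u t := by
  intro t _
  obtain ⟨k, hk, hkt⟩ := hU.eventually_flatSection_eq hv (continuous_path σ) hu
    (hU.mem (path σ t))
  refine ⟨e (path σ t), fun _ ↦ a * k, 0, hU.smooth _, hU.ne_zero _ _ (hU.mem _), ?_,
    hasDerivWithinAt_const _ _ _, ?_⟩
  · filter_upwards [mem_nhdsWithin_of_mem_nhds hkt] with r hr
    rw [hr, smul_smul]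
  · rw [hU.flat _ _ (hU.mem _)]
    simp

theorem hasDerivWithinAt_comp_path {σ : Simplex X 1} (hσ : IsSmoothPath (n := n) σ) {t : ℝ}
    (ht : t ∈ Icc (0 : ℝ) 1) {q : X → ℝ} (hq : MDifferentiableAt (𝓡 n) 𝓘(ℝ, ℝ) q (path σ t)) :
    HasDerivWithinAt (fun r ↦ q (path σ r)) (mvfderiv (𝓡 n) q (path σ t) (velocity σ t))
      (Icc 0 1) t := by
  have h1 : MDifferentiableWithinAt 𝓘(ℝ, ℝ) (𝓡 n) (path σ) (Icc 0 1) t :=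
    (hσ t ht).mdifferentiableWithinAt (by simp)
  have h2 := hq.hasMFDerivAt.comp_hasMFDerivWithinAt t h1.hasMFDerivWithinAt
  let L : ℝ →L[ℝ] ℝ := (mvfderiv (𝓡 n) q (path σ t)).comp
    (mfderivWithin 𝓘(ℝ, ℝ) (𝓡 n) (path σ) (Icc 0 1) t : ℝ →L[ℝ] TangentSpace (𝓡 n) (path σ t))
  have h3 : HasFDerivWithinAt (fun r ↦ q (path σ r)) L (Icc 0 1) t :=
    hasMFDerivWithinAt_iff_hasFDerivWithinAt.1 h2
  exact h3.hasDerivWithinAt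

/-- Uniqueness of parallel transport: the quotient of `s` by the flat section has zero derivative on
`[0, 1]`. -/
theorem IsFlatAtlas.eq_smul_flatSection (hU : IsFlatAtlas D U e)
    (hv : ∀ x, v x ≠ 0) {σ : Simplex X 1} (hσ : IsSmoothPath (n := n) σ) {u : ℝ → Additive ℝˣ}
    (hu : IsPrimitiveAlong U (fun x y ↦ unitRatio (e x y) (v y)) (path σ) u)
    {s : Π t : ℝ, l (path σ t)} (hs : IsParallelAlong D σ s) :
    ∃ a : ℝ, ∀ t ∈ Icc (0 : ℝ) 1, s t = a • flatSection v (path σ) u t := by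
  let w : ℝ → ℝ := fun t ↦ fiberRatio (flatSection v (path σ) u t) (s t)
  have hw : ∀ t ∈ Icc (0 : ℝ) 1, HasDerivWithinAt w 0 (Icc 0 1) t := by
    intro t ht
    obtain ⟨e', a, a', he', he'0, hse', ha, hpar⟩ := hs t ht
    obtain ⟨k, hk, hkt⟩ := hU.eventually_flatSection_eq hv (continuous_path σ) hu
      (hU.mem (path σ t))
    let x := path σ t
    let q : X → ℝ := fun y ↦ fiberRatio (e x y) (e' y)
    have hx0 : e x x ≠ 0 := hU.ne_zero _ _ (hU.mem x)
    have hq : MDifferentiableAt (𝓡 n) 𝓘(ℝ, ℝ) q x :=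
      ((hU.smooth x).contMDiffAt_fiberRatio he' hx0).mdifferentiableAt (by simp)
    have hqe : ∀ᶠ y in 𝓝 x, e' y = q y • e x y := by
      filter_upwards [(hU.isOpen x).mem_nhds (hU.mem x)] with y hy
      exact (fiberRatio_smul (hU.ne_zero x y hy) _).symm
    have hqσ := hasDerivWithinAt_comp_path hσ ht hq
    have heq : ∀ᶠ r in 𝓝[Icc 0 1] t, w r = a r * q (path σ r) * k⁻¹ := by
      filter_upwards [hse', mem_nhdsWithin_of_mem_nhds hkt,
        mem_nhdsWithin_of_mem_nhds ((continuous_path σ).continuousAt.eventually hqe)]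
        with r h1 h2 h3
      refine (fiberRatio_eq_iff (flatSection_ne_zero hv r)).2 ?_
      rw [h1, h2, h3, smul_smul, smul_smul, mul_assoc, inv_mul_cancel₀ hk, mul_one]
    have hD' := covariantDerivative_of_eventuallyEq_smul D ((hU.smooth x).isDiffSectionAt x) hq
      hqe (velocity σ t)
    rw [hU.flat x x (hU.mem x)] at hD'
    -- The parallel equation, expressed in the flat frame, says precisely that the product `a * q`
    -- along the path has zero derivative at `t`.
    have hz : a' * q x + a t * mvfderiv (𝓡 n) q x (velocity σ t) = 0 := by
      rw [hD', hqe.self_of_nhds] at hpar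
      simp only [_root_.zero_apply, smul_zero, zero_add, smul_smul, ← add_smul] at hpar
      exact (smul_eq_zero_iff_left hx0).1 hpar
    have hder := (ha.mul hqσ).mul_const k⁻¹
    rw [hz, zero_mul] at hder
    exact hder.congr_of_eventuallyEq heq (heq.self_of_nhdsWithin ht)
  refine ⟨w 0, fun t ht ↦ ?_⟩
  have hconst : w t = w 0 := by
    refine (convex_Icc (0 : ℝ) 1).is_const_of_fderivWithin_eq_zero (𝕜 := ℝ)
      (fun r hr ↦ (hw r hr).differentiableWithinAt) (fun r hr ↦ ?_) ht (by simp)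
    ext
    exact (hw r hr).derivWithin (uniqueDiffOn_Icc zero_lt_one r hr)
  rw [← hconst, fiberRatio_smul (flatSection_ne_zero hv t)]

theorem exists_ne_zero_section (l : X → Type*) [TopologicalSpace (TotalSpace ℝ l)]
    [∀ x, AddCommGroup (l x)] [∀ x, Module ℝ (l x)] [∀ x, TopologicalSpace (l x)]
    [FiberBundle ℝ l] [VectorBundle ℝ ℝ l] : ∃ v : Π x : X, l x, ∀ x, v x ≠ 0 := by
  refine ⟨fun x ↦ ((trivializationAt ℝ l x).continuousLinearEquivAt ℝ x
    (FiberBundle.mem_baseSet_trivializationAt' x)).symm 1, fun x ↦ ?_⟩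
  rw [ne_eq, ContinuousLinearEquiv.map_eq_zero_iff]
  exact one_ne_zero

theorem flatSection_endpoints {g : ℝ → X} {u : ℝ → Additive ℝˣ} {c : Additive ℝˣ}
    (hc : c = u 1 - u 0) :
    v (g 1) = unitVal c • unitVal (u 0) • flatSection v g u 1 := by
  have h0 := unitVal_ne_zero (u 0)
  have h1 := unitVal_ne_zero (u 1)
  rw [hc, unitVal_sub, flatSection, smul_smul, smul_smul, div_mul_cancel₀ _ h0, mul_inv_cancel₀ h1,
    one_smul]

/-- The cocycle obtained by integrating the quotients of `v` by the flat frames represents the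
holonomy class, and it is the only holonomy class. -/
theorem IsFlatAtlas.isHolonomyClass_iff [IsManifold (𝓡 n) ∞ X] (hU : IsFlatAtlas D U e)
    (hv : ∀ x, v x ≠ 0) {f : cocycles₁ X (Additive ℝˣ)}
    (hf : ∀ σ : Simplex X 1, ∃ u : ℝ → Additive ℝˣ,
      IsPrimitiveAlong U (fun x y ↦ unitRatio (e x y) (v y)) (path σ) u ∧ f.1 σ = u 1 - u 0)
    (a : H1 X (Additive ℝˣ)) : IsHolonomyClass D a ↔ a = H1.mk f := by
  constructor
  · rintro ⟨f', rfl, v', hv', hs⟩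
    -- Replacing the reference vectors `v` by `v'` changes the cocycle by the coboundary of `v' /
    -- v`.
    let γ : X → Additive ℝˣ := fun x ↦ unitRatio (v x) (v' x)
    obtain ⟨f'', hf'', hf''σ⟩ := exists_cocycle_add_coboundary f γ
    rw [← hf'']
    congr 1
    refine cocycle_ext_of_smooth (n := n) fun σ hσ ↦ ?_
    obtain ⟨u, hu, huf⟩ := hf σ
    obtain ⟨s, hs, hs0, hs1⟩ := hs σ hσ
    obtain ⟨a, ha⟩ := hU.eq_smul_flatSection hv hσ hu hs
    have h0 := unitVal_ne_zero (u 0)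
    have h1 := unitVal_ne_zero (u 1)
    have hγ : ∀ x, unitVal (γ x) • v x = v' x := fun x ↦ unitRatio_smul (hv x) (hv' x)
    have hγ0 := unitVal_ne_zero (γ (path σ 0))
    rw [ha 0 (by simp), flatSection, ← hγ, smul_smul] at hs0
    have ha0 := (smul_left_injective ℝ (hv _) hs0).symm
    rw [ha 1 (by simp), flatSection, ← hγ, smul_smul, smul_smul] at hs1
    have ha1 := smul_left_injective ℝ (hv _) hs1
    change unitVal (γ (path σ 0)) = a * (unitVal (u 0))⁻¹ at ha0
    change unitVal (γ (path σ 1)) = unitVal (f'.1 σ) * a * (unitVal (u 1))⁻¹ at ha1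
    apply unitVal_injective
    rw [hf''σ, huf, unitVal_add, unitVal_sub, unitVal_sub, ha1, ha0]
    have ha' : a ≠ 0 := by
      rintro rfl
      rw [zero_mul] at ha0
      exact hγ0 ha0
    field_simp
  · rintro rfl
    refine ⟨f, rfl, v, hv, fun σ _ ↦ ?_⟩
    obtain ⟨u, hu, huf⟩ := hf σ
    refine ⟨_, hU.isParallelAlong hv hu (unitVal (u 0)), ?_, flatSection_endpoints huf⟩
    simp only [flatSection]
    rw [smul_smul, mul_inv_cancel₀ (unitVal_ne_zero _), one_smul]

end Parallel

/-! ### The first Stiefel-Whitney class -/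

theorem sign_eq_zero_iff {a : Additive ℝˣ} : sign a = 0 ↔ 0 < unitVal a := by
  change Additive.ofMul (if 0 < unitVal a then (1 : ℤˣ) else -1) = 0 ↔ _
  rw [ofMul_eq_zero]
  split_ifs with h <;> simp [h]

theorem additive_intUnits_ext {a b : Additive ℤˣ} (h : a = 0 ↔ b = 0) : a = b := by
  have key : ∀ c : Additive ℤˣ, c = 0 ∨ c = Additive.ofMul (-1) := fun c ↦
    Int.units_eq_one_or c.toMul
  have hne : (Additive.ofMul (-1) : Additive ℤˣ) ≠ 0 := by decide
  rcases key a with rfl | rfl <;> rcases key b with rfl | rfl <;> simp_all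

section StiefelWhitney

set_option linter.unusedSectionVars false

variable {X : Type*} [TopologicalSpace X] {l : X → Type*} [TopologicalSpace (TotalSpace ℝ l)]
  [∀ x, AddCommGroup (l x)]

/-- Triviality over a loop decides a value in `{±1}`, and values on loops decide the class. -/
theorem IsFirstStiefelWhitneyClass.eq {a b : H1 X (Additive ℤˣ)}
    (ha : IsFirstStiefelWhitneyClass l a) (hb : IsFirstStiefelWhitneyClass l b) : a = b := by
  obtain ⟨f, rfl, hf⟩ := ha
  obtain ⟨f', rfl, hf'⟩ := hb
  exact H1_mk_eq_of_loops fun ρ hρ ↦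
    additive_intUnits_ext ((hf ρ hρ).trans (hf' ρ hρ).symm)

variable [∀ x, Module ℝ (l x)] [∀ x, TopologicalSpace (l x)]
  [∀ x, IsTopologicalAddGroup (l x)] [∀ x, ContinuousSMul ℝ (l x)]
  [FiberBundle ℝ l] [VectorBundle ℝ ℝ l]
  {Y : Type*} [TopologicalSpace Y] {S : Set Y} {g : Y → X} {t : Y}

theorem continuousWithinAt_smul_section {c : Y → ℝ} {s : Π t, l (g t)}
    (hc : ContinuousWithinAt c S t)
    (hs : ContinuousWithinAt (fun t ↦ TotalSpace.mk' ℝ (g t) (s t)) S t) :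
    ContinuousWithinAt (fun t ↦ TotalSpace.mk' ℝ (g t) (c t • s t)) S t := by
  rw [FiberBundle.continuousWithinAt_totalSpace] at hs ⊢
  refine ⟨hs.1, ?_⟩
  have hb := FiberBundle.mem_baseSet_trivializationAt' (F := ℝ) (E := l) (g t)
  have hlin : ∀ y, g y ∈ (trivializationAt ℝ l (g t)).baseSet →
      (trivializationAt ℝ l (g t) (TotalSpace.mk' ℝ (g y) (c y • s y))).2
        = c y * (trivializationAt ℝ l (g t) (TotalSpace.mk' ℝ (g y) (s y))).2 := fun y hy ↦
    ((trivializationAt ℝ l (g t)).linear ℝ hy).2 (c y) (s y)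
  refine (hc.mul hs.2).congr_of_eventuallyEq ?_ (hlin t hb)
  filter_upwards [hs.1 ((trivializationAt ℝ l (g t)).open_baseSet.mem_nhds hb)] with y hy
  exact hlin y hy

theorem continuousWithinAt_fiberRatio {e s : Π t, l (g t)}
    (he : ContinuousWithinAt (fun t ↦ TotalSpace.mk' ℝ (g t) (e t)) S t)
    (hs : ContinuousWithinAt (fun t ↦ TotalSpace.mk' ℝ (g t) (s t)) S t)
    (he0 : ∀ t, e t ≠ 0) :
    ContinuousWithinAt (fun t ↦ fiberRatio (e t) (s t)) S t := by
  rw [FiberBundle.continuousWithinAt_totalSpace] at he hs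
  have hb := FiberBundle.mem_baseSet_trivializationAt' (F := ℝ) (E := l) (g t)
  refine (hs.2.div he.2 (trivialization_snd_ne_zero (he0 t) hb)).congr_of_eventuallyEq ?_
    (fiberRatio_eq_div (he0 t) hb)
  filter_upwards [hs.1 ((trivializationAt ℝ l (g t)).open_baseSet.mem_nhds hb)] with y hy
  exact fiberRatio_eq_div (he0 y) hy

variable {n : ℕ} [ChartedSpace (EuclideanSpace ℝ (Fin n)) X] [ContMDiffVectorBundle ∞ ℝ l (𝓡 n)]
  {D : CovariantDerivative (𝓡 n) ℝ l} {U : X → Set X} {e : X → Π y : X, l y} {v : Π x : X, l x}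

theorem IsFlatAtlas.continuous_flatSection (hU : IsFlatAtlas D U e) (hv : ∀ x, v x ≠ 0)
    (hg : Continuous g) {u : Y → Additive ℝˣ}
    (hu : IsPrimitiveAlong U (fun x y ↦ unitRatio (e x y) (v y)) g u) :
    Continuous fun t ↦ TotalSpace.mk' ℝ (g t) (flatSection v g u t) := by
  rw [continuous_iff_continuousAt]
  intro t
  obtain ⟨k, hk, hkt⟩ := hU.eventually_flatSection_eq hv hg hu (hU.mem (g t))
  have h1 : ContinuousAt (fun r ↦ TotalSpace.mk' ℝ (g r) (e (g t) (g r))) t :=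
    ((hU.smooth (g t)).continuous.comp hg).continuousAt
  have h2 := continuousWithinAt_smul_section (c := fun _ ↦ k) (S := univ)
    continuousWithinAt_const h1.continuousWithinAt
  rw [continuousWithinAt_univ] at h2
  refine h2.congr ?_
  filter_upwards [hkt] with r hr
  rw [hr]

/-- The sign of the holonomy class is the first Stiefel-Whitney class. -/
theorem IsFlatAtlas.isFirstStiefelWhitneyClass (hU : IsFlatAtlas D U e) (hv : ∀ x, v x ≠ 0)
    {f : cocycles₁ X (Additive ℝˣ)}
    (hf : ∀ σ : Simplex X 1, ∃ u : ℝ → Additive ℝˣ,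
      IsPrimitiveAlong U (fun x y ↦ unitRatio (e x y) (v y)) (path σ) u ∧ f.1 σ = u 1 - u 0) :
    IsFirstStiefelWhitneyClass l (H1.map X sign (H1.mk f)) := by
  refine ⟨cocyclesMap X sign f, rfl, fun ρ hρ ↦ ?_⟩
  change sign (f.1 ρ) = 0 ↔ _
  rw [sign_eq_zero_iff]
  obtain ⟨u, hu, huf⟩ := hf ρ
  have hcont := hU.continuous_flatSection hv (continuous_path ρ) hu
  have h0 := unitVal_ne_zero (u 0)
  have h1 := unitVal_ne_zero (u 1)
  have hc : unitVal (f.1 ρ) = unitVal (u 1) / unitVal (u 0) := by rw [huf, unitVal_sub]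
  constructor
  · intro hpos
    -- The positive factor moves from `1` to the value of `f` on `ρ`, compensating the holonomy so
    -- that the section closes up.
    refine ⟨fun t ↦ Real.exp (t * Real.log (unitVal (f.1 ρ))) • flatSection v (path ρ) u t,
      fun t _ ↦ ?_, fun t _ ↦ smul_ne_zero (Real.exp_ne_zero _) (flatSection_ne_zero hv t), ?_⟩
    · exact continuousWithinAt_smul_section (by fun_prop) hcont.continuousWithinAt
    · have e0 : Real.exp (0 * Real.log (unitVal (f.1 ρ))) • flatSection v (path ρ) u 0
          = (unitVal (u 0))⁻¹ • v (path ρ 0) := by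
        simp [flatSection]
      have e1 : Real.exp (1 * Real.log (unitVal (f.1 ρ))) • flatSection v (path ρ) u 1
          = (unitVal (u 0))⁻¹ • v (path ρ 1) := by
        rw [one_mul, Real.exp_log hpos, flatSection, smul_smul, hc]
        congr 1
        field_simp
      simp only [e0, e1]
      exact congrArg (fun y ↦ TotalSpace.mk' ℝ y ((unitVal (u 0))⁻¹ • v y)) hρ
  · rintro ⟨s, hs, hs0, hs01⟩
    -- Compared with the flat section, `s` has a continuous nonvanishing coefficient, so `w 0` and
    -- `w 1` have the same sign. Closing up forces the holonomy to equal `w 1 / w 0`.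
    let w : ℝ → ℝ := fun t ↦ fiberRatio (flatSection v (path ρ) u t) (s t)
    have hwc : ContinuousOn w (Icc 0 1) := fun t ht ↦
      continuousWithinAt_fiberRatio hcont.continuousWithinAt (hs t ht) (flatSection_ne_zero hv)
    have hw0 : ∀ t ∈ Icc (0 : ℝ) 1, w t ≠ 0 := fun t ht ↦
      fiberRatio_ne_zero (flatSection_ne_zero hv t) (hs0 t ht)
    have hratio : ∀ t ∈ Icc (0 : ℝ) 1,
        fiberRatio (v (path ρ t)) (s t) = w t * (unitVal (u t))⁻¹ := by
      intro t ht
      rw [fiberRatio_eq_iff (hv _), mul_smul]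
      exact (fiberRatio_smul (flatSection_ne_zero hv t) _).symm
    have h01 : fiberRatio (v (path ρ 0)) (s 0) = fiberRatio (v (path ρ 1)) (s 1) :=
      congrArg (fun p : TotalSpace ℝ l ↦ fiberRatio (v p.proj) p.2) hs01
    rw [hratio 0 (by simp), hratio 1 (by simp)] at h01
    have hw01 : 0 < w 0 * w 1 := by
      by_contra hneg
      have hmem : (0 : ℝ) ∈ w '' Icc 0 1 := by
        have hpre := (isPreconnected_Icc (a := (0 : ℝ)) (b := 1)).image w hwc
        have hm0 : w 0 ∈ w '' Icc 0 1 := mem_image_of_mem _ (by simp)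
        have hm1 : w 1 ∈ w '' Icc 0 1 := mem_image_of_mem _ (by simp)
        rcases mul_nonpos_iff.1 (not_lt.1 hneg) with h | h
        · exact hpre.ordConnected.out hm1 hm0 ⟨h.2, h.1⟩
        · exact hpre.ordConnected.out hm0 hm1 ⟨h.1, h.2⟩
      obtain ⟨t, ht, ht0⟩ := hmem
      exact hw0 t ht ht0
    have hw00 := hw0 0 (by simp)
    have hq : unitVal (u 1) / unitVal (u 0) = w 0 * w 1 / (w 0 * w 0) := by
      field_simp
      field_simp at h01
      linarith
    rw [hc, hq]
    exact div_pos hw01 (mul_self_pos.2 hw00)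

end StiefelWhitney

/-! ### The coefficient decomposition -/

section Decomposition

variable {X : Type*} [TopologicalSpace X]

theorem H1.map_map {A B C : Type*} [AddCommGroup A] [AddCommGroup B] [AddCommGroup C]
    (φ : A →+ B) (ψ : B →+ C) (a : H1 X A) : H1.map X ψ (H1.map X φ a) = H1.map X (ψ.comp φ) a := by
  obtain ⟨f, rfl⟩ := H1_mk_surjective a
  rfl

theorem H1.map_id {A : Type*} [AddCommGroup A] (a : H1 X A) :
    H1.map X (AddMonoidHom.id A) a = a := by
  obtain ⟨f, rfl⟩ := H1_mk_surjective a
  rfl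

theorem H1.map_zero_hom {A B : Type*} [AddCommGroup A] [AddCommGroup B] (a : H1 X A) :
    H1.map X (0 : A →+ B) a = 0 := by
  obtain ⟨f, rfl⟩ := H1_mk_surjective a
  exact map_zero (H1.mk : cocycles₁ X B →+ H1 X B)

theorem H1.map_add_hom {A B : Type*} [AddCommGroup A] [AddCommGroup B] (φ ψ : A →+ B)
    (a : H1 X A) : H1.map X (φ + ψ) a = H1.map X φ a + H1.map X ψ a := by
  obtain ⟨f, rfl⟩ := H1_mk_surjective a
  exact map_add (H1.mk : cocycles₁ X B →+ H1 X B) (cocyclesMap X φ f) (cocyclesMap X ψ f)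

theorem unitVal_expHom (t : ℝ) : unitVal (expHom t) = Real.exp t := rfl

theorem unitVal_signIncl (a : Additive ℤˣ) : unitVal (signIncl a) = ((a.toMul : ℤˣ) : ℤ) := rfl

theorem lnAbs_apply (a : Additive ℝˣ) : lnAbs a = Real.log |unitVal a| := rfl

theorem sign_comp_signIncl : sign.comp signIncl = AddMonoidHom.id _ := by
  refine AddMonoidHom.ext fun a ↦ ?_
  refine additive_intUnits_ext ?_
  change sign (signIncl a) = 0 ↔ _
  rw [sign_eq_zero_iff, unitVal_signIncl]
  rcases Int.units_eq_one_or a.toMul with h | h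
  · have : a = 0 := h
    simp [this]
  · have : a = Additive.ofMul (-1) := h
    subst this
    simp

theorem sign_comp_expHom : sign.comp expHom = 0 := by
  refine AddMonoidHom.ext fun t ↦ ?_
  exact (sign_eq_zero_iff (a := expHom t)).2 (Real.exp_pos t)

theorem lnAbs_comp_signIncl : lnAbs.comp signIncl = 0 := by
  refine AddMonoidHom.ext fun a ↦ ?_
  change lnAbs (signIncl a) = 0
  rw [lnAbs_apply, unitVal_signIncl]
  rcases Int.units_eq_one_or a.toMul with h | h <;> simp [h]

theorem lnAbs_comp_expHom : lnAbs.comp expHom = AddMonoidHom.id ℝ := by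
  refine AddMonoidHom.ext fun t ↦ ?_
  change lnAbs (expHom t) = t
  rw [lnAbs_apply, unitVal_expHom, abs_of_pos (Real.exp_pos t), Real.log_exp]

/-- The identity `x = sign(x) exp(ln|x|)`. Together with the four composites above, it makes `sign`
and `lnAbs` the components of a two-sided inverse of `decomposition`. -/
theorem signIncl_sign_add_expHom_lnAbs :
    signIncl.comp sign + expHom.comp lnAbs = AddMonoidHom.id (Additive ℝˣ) := by
  refine AddMonoidHom.ext fun a ↦ ?_
  apply unitVal_injective
  change unitVal (signIncl (sign a) + expHom (lnAbs a)) = unitVal a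
  rw [unitVal_add, unitVal_expHom, lnAbs_apply, Real.exp_log (abs_pos.2 (unitVal_ne_zero a)),
    unitVal_signIncl]
  change (((if 0 < unitVal a then (1 : ℤˣ) else -1 : ℤˣ) : ℤ) : ℝ) * _ = _
  split_ifs with h
  · simp [abs_of_pos h]
  · simp [abs_of_nonpos (not_lt.1 h)]

theorem decomposition_apply (p : H1 X (Additive ℤˣ) × H1 X ℝ) :
    decomposition X p = H1.map X signIncl p.1 + H1.map X expHom p.2 := rfl

theorem decomposition_sign_lnAbs (c : H1 X (Additive ℝˣ)) :
    decomposition X (H1.map X sign c, H1.map X lnAbs c) = c := by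
  rw [decomposition_apply, H1.map_map, H1.map_map, ← H1.map_add_hom,
    signIncl_sign_add_expHom_lnAbs, H1.map_id]

theorem sign_decomposition (p : H1 X (Additive ℤˣ) × H1 X ℝ) :
    H1.map X sign (decomposition X p) = p.1 := by
  rw [decomposition_apply, map_add, H1.map_map, H1.map_map, sign_comp_signIncl, sign_comp_expHom,
    H1.map_id, H1.map_zero_hom, add_zero]

theorem lnAbs_decomposition (p : H1 X (Additive ℤˣ) × H1 X ℝ) :
    H1.map X lnAbs (decomposition X p) = p.2 := by
  rw [decomposition_apply, map_add, H1.map_map, H1.map_map, lnAbs_comp_signIncl,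
    lnAbs_comp_expHom, H1.map_id, H1.map_zero_hom, zero_add]

theorem decomposition_bijective : Function.Bijective (decomposition X) :=
  ⟨fun p q h ↦ Prod.ext (by rw [← sign_decomposition p, h, sign_decomposition])
    (by rw [← lnAbs_decomposition p, h, lnAbs_decomposition]),
    fun c ↦ ⟨_, decomposition_sign_lnAbs c⟩⟩

end Decomposition

/-! ### The holonomy form along flat sections -/

section HolonomyForm

set_option linter.unusedSectionVars false

variable {n : ℕ} {X : Type*} [TopologicalSpace X] [ChartedSpace (EuclideanSpace ℝ (Fin n)) X]
  [IsManifold (𝓡 n) ∞ X]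
  {l : X → Type*} [TopologicalSpace (TotalSpace ℝ l)]
  [∀ x, AddCommGroup (l x)] [∀ x, Module ℝ (l x)] [∀ x, TopologicalSpace (l x)]
  [∀ x, IsTopologicalAddGroup (l x)] [∀ x, ContinuousSMul ℝ (l x)]
  [FiberBundle ℝ l] [VectorBundle ℝ ℝ l] [ContMDiffVectorBundle ∞ ℝ l (𝓡 n)]

/-- An endomorphism of a line is a scalar, and in dimension one the trace of a scalar is that
scalar. -/
theorem trace_smul_eq {x : X} (T : l x →ₗ[ℝ] l x) (v : l x) :
    LinearMap.trace ℝ (l x) T • v = T v := by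
  let L := ((trivializationAt ℝ l x).continuousLinearEquivAt ℝ x
    (FiberBundle.mem_baseSet_trivializationAt' x)).toLinearEquiv
  have : Module.Finite ℝ (l x) := Module.Finite.equiv L.symm
  have hfin : Module.finrank ℝ (l x) = 1 := by
    rw [L.finrank_eq, Module.finrank_self]
  have he : L.symm 1 ≠ 0 := by simp
  obtain ⟨a, ha⟩ := exists_smul_eq he (T (L.symm 1))
  have hT : T = a • LinearMap.id := by
    ext w
    obtain ⟨b, rfl⟩ := exists_smul_eq he w
    simp [ha]
  rw [hT, map_smul, LinearMap.trace_id, hfin]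
  simp

/-- The holonomy form is characterized by `D e - ∇_h e = θ(D, h) e`. -/
theorem holonomyForm_smul (D : CovariantDerivative (𝓡 n) ℝ l)
    (h : ContMDiffRiemannianMetric (𝓡 n) ∞ ℝ l) {e : Π x : X, l x} {x : X}
    (he : IsDiffSectionAt (n := n) e x) (W : TangentSpace (𝓡 n) x) :
    holonomyForm D h x W • e x = D e x W - metricConnection h e x W := by
  have : ContMDiffVectorBundle 1 ℝ l (𝓡 n) := ContMDiffVectorBundle.of_le (n := ∞) (by simp)
  have h1 : D.difference (metricConnection h) x (e x) = D e x - metricConnection h e x :=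
    IsCovariantDerivativeOn.difference_apply D.isCovariantDerivativeOnUniv
      (metricConnection h).isCovariantDerivativeOnUniv (mem_univ x) he
  have h2 := trace_smul_eq (LinearMap.flip (R := ℝ) (ContinuousLinearMap.coeLM ℝ ∘ₗ
        (D.difference (metricConnection h) x).toLinearMap) W) (e x)
  refine Eq.trans h2 ?_
  change D.difference (metricConnection h) x (e x) W = _
  rw [h1]
  rfl

theorem contMDiffAt_inner (h : ContMDiffRiemannianMetric (𝓡 n) ∞ ℝ l) {e : Π x : X, l x}
    (he : IsSmoothSection (n := n) e) (x : X) :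
    ContMDiffAt (𝓡 n) 𝓘(ℝ, ℝ) ∞ (fun y ↦ h.inner y (e y) (e y)) x := by
  have h1 : ContMDiffAt (𝓡 n) ((𝓡 n).prod 𝓘(ℝ, ℝ)) ∞
      (fun m ↦ TotalSpace.mk' ℝ (E := Bundle.Trivial X ℝ) m (h.inner m (e m) (e m))) x :=
    ContMDiffAt.clm_bundle_apply₂ (F₁ := ℝ) (F₂ := ℝ) h.contMDiff.contMDiffAt (he x) (he x)
  rw [contMDiffAt_totalSpace] at h1
  exact h1.2

/-- Half the logarithm of the square norm of a vector. -/
def logNorm (h : ContMDiffRiemannianMetric (𝓡 n) ∞ ℝ l) {x : X} (v : l x) : ℝ :=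
  Real.log (h.inner x v v) / 2

theorem logNorm_smul (h : ContMDiffRiemannianMetric (𝓡 n) ∞ ℝ l) {x : X} {v : l x} (hv : v ≠ 0)
    {k : ℝ} (hk : k ≠ 0) : logNorm h (k • v) = Real.log |k| + logNorm h v := by
  have hpos := h.pos x v hv
  have : h.inner x (k • v) (k • v) = |k| ^ 2 * h.inner x v v := by
    simp [sq_abs]; ring
  rw [logNorm, logNorm, this, Real.log_mul (by simpa using hk) hpos.ne', Real.log_pow]
  push_cast
  ring

theorem contMDiffAt_logNorm (h : ContMDiffRiemannianMetric (𝓡 n) ∞ ℝ l) {e : Π x : X, l x}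
    (he : IsSmoothSection (n := n) e) {x : X} (hx : e x ≠ 0) :
    ContMDiffAt (𝓡 n) 𝓘(ℝ, ℝ) ∞ (fun y ↦ logNorm h (e y)) x := by
  have h1 : ContDiffAt ℝ ∞ (fun r : ℝ ↦ Real.log r / 2) (h.inner x (e x) (e x)) :=
    (Real.contDiffAt_log.2 (h.pos x _ hx).ne').div_const 2
  exact h1.contMDiffAt.comp x (contMDiffAt_inner h he x)

/-- The logarithm of the norm of a flat frame is a primitive of `-θ(D, h)`. -/
theorem mvfderiv_logNorm (D : CovariantDerivative (𝓡 n) ℝ l)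
    (h : ContMDiffRiemannianMetric (𝓡 n) ∞ ℝ l) {e : Π x : X, l x}
    (he : IsSmoothSection (n := n) e) {x : X} (hx : e x ≠ 0) (hD : D e x = 0)
    (W : TangentSpace (𝓡 n) x) :
    mvfderiv (𝓡 n) (fun y ↦ logNorm h (e y)) x W = -holonomyForm D h x W := by
  have hpos := h.pos x _ hx
  have hde := he.isDiffSectionAt x
  have hθ := holonomyForm_smul D h hde W
  rw [hD] at hθ
  -- For a flat frame `∇_h e = -θ e`, so compatibility gives `d h(e, e) = -2 θ h(e, e)`; the half in
  -- `logNorm` absorbs the factor `2`.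
  have hmet : metricConnection h e x W = -(holonomyForm D h x W) • e x := by
    rw [neg_smul, hθ]; simp
  have hcomp : mvfderiv (𝓡 n) (fun y ↦ h.inner y (e y) (e y)) x W
      = h.inner x (metricConnection h e x W) (e x) + h.inner x (e x) (metricConnection h e x W) :=
    (exists_isCompatible h).choose_spec e e x hde hde W
  have hd : MDifferentiableAt (𝓡 n) 𝓘(ℝ, ℝ) (fun y ↦ h.inner y (e y) (e y)) x :=
    mdifferentiableAt_inner h hde hde
  have hlog : HasDerivAt (fun r : ℝ ↦ Real.log r / 2) ((h.inner x (e x) (e x))⁻¹ / 2)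
      (h.inner x (e x) (e x)) := (Real.hasDerivAt_log hpos.ne').div_const 2
  have hchain := (hlog.hasFDerivAt.hasMFDerivAt.comp x (f := fun y ↦ h.inner y (e y) (e y))
    hd.hasMFDerivAt).mfderiv
  have hval : mvfderiv (𝓡 n) (fun y ↦ logNorm h (e y)) x W
      = mvfderiv (𝓡 n) (fun y ↦ h.inner y (e y) (e y)) x W *
        ((h.inner x (e x) (e x))⁻¹ / 2) := by
    change (mfderiv (𝓡 n) 𝓘(ℝ, ℝ) ((fun r : ℝ ↦ Real.log r / 2) ∘
      fun y ↦ h.inner y (e y) (e y)) x W : ℝ) = _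
    rw [hchain]
    rfl
  rw [hval, hcomp, hmet]
  simp only [map_smul, _root_.smul_apply, smul_eq_mul]
  field_simp
  ring

variable {D : CovariantDerivative (𝓡 n) ℝ l} {U : X → Set X} {e : X → Π y : X, l y}
  {v : Π x : X, l x}

/-- The integral of the holonomy form along a smooth path. -/
theorem IsFlatAtlas.integral_holonomyForm (hU : IsFlatAtlas D U e) (hv : ∀ x, v x ≠ 0)
    (h : ContMDiffRiemannianMetric (𝓡 n) ∞ ℝ l) {σ : Simplex X 1} (hσ : IsSmoothPath (n := n) σ)
    {u : ℝ → Additive ℝˣ}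
    (hu : IsPrimitiveAlong U (fun x y ↦ unitRatio (e x y) (v y)) (path σ) u) :
    ∫ t in (0 : ℝ)..1, holonomyForm D h (path σ t) (velocity σ t)
      = logNorm h (flatSection v (path σ) u 0) - logNorm h (flatSection v (path σ) u 1) := by
  let N : ℝ → ℝ := fun t ↦ logNorm h (flatSection v (path σ) u t)
  have hloc : ∀ t ∈ Icc (0 : ℝ) 1, ContDiffWithinAt ℝ 1 N (Icc 0 1) t ∧
      HasDerivWithinAt N (-holonomyForm D h (path σ t) (velocity σ t)) (Icc 0 1) t := by
    intro t ht
    let x := path σ t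
    have hx0 : e x x ≠ 0 := hU.ne_zero _ _ (hU.mem x)
    obtain ⟨k, hk, hkt⟩ := hU.eventually_flatSection_eq hv (continuous_path σ) hu (hU.mem x)
    have heq : ∀ᶠ r in 𝓝 t, N r = Real.log |k| + logNorm h (e x (path σ r)) := by
      filter_upwards [hkt, (continuous_path σ).continuousAt.eventually
        ((hU.isOpen x).mem_nhds (hU.mem x))] with r hr hrU
      simp only [N]
      rw [hr, logNorm_smul h (hU.ne_zero x _ hrU) hk]
    have hs := contMDiffAt_logNorm h (hU.smooth x) hx0
    constructor
    · have h1 : ContMDiffWithinAt 𝓘(ℝ, ℝ) 𝓘(ℝ, ℝ) ∞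
          (fun r ↦ logNorm h (e x (path σ r))) (Icc 0 1) t := hs.comp_contMDiffWithinAt t (hσ t ht)
      have h2 := (contDiffWithinAt_const (c := Real.log |k|)).add
        (h1.contDiffWithinAt.of_le (m := 1) (by simp))
      exact h2.congr_of_eventuallyEq (mem_nhdsWithin_of_mem_nhds heq) heq.self_of_nhds
    · have h1 := (hasDerivWithinAt_comp_path hσ ht (hs.mdifferentiableAt (by simp))).const_add
        (Real.log |k|)
      rw [mvfderiv_logNorm D h (hU.smooth x) hx0 (hU.flat _ _ (hU.mem x))] at h1
      exact h1.congr_of_eventuallyEq (mem_nhdsWithin_of_mem_nhds heq) heq.self_of_nhds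
  have hN : ContDiffOn ℝ 1 N (Icc 0 1) := fun t ht ↦ (hloc t ht).1
  -- Continuity of the integrand comes from `N` being `C¹`; smoothness of the holonomy form itself
  -- is never needed.
  have hcont : ContinuousOn (fun t ↦ -holonomyForm D h (path σ t) (velocity σ t)) (Icc 0 1) :=
    (hN.continuousOn_derivWithin (uniqueDiffOn_Icc zero_lt_one) le_rfl).congr fun t ht ↦
      ((hloc t ht).2.derivWithin (uniqueDiffOn_Icc zero_lt_one t ht)).symm
  have hint := intervalIntegral.integral_eq_sub_of_hasDerivAt_of_le (zero_le_one' ℝ)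
    hN.continuousOn
    (fun t ht ↦ (hloc t (Ioo_subset_Icc_self ht)).2.hasDerivAt (Icc_mem_nhds ht.1 ht.2))
    (hcont.intervalIntegrable_of_Icc zero_le_one)
  rw [intervalIntegral.integral_neg] at hint
  linarith

/-- The logarithm of the absolute value of the holonomy class is the de Rham class of the
holonomy form. -/
theorem IsFlatAtlas.isDeRhamClass_iff (hU : IsFlatAtlas D U e) (hv : ∀ x, v x ≠ 0)
    {f : cocycles₁ X (Additive ℝˣ)}
    (hf : ∀ σ : Simplex X 1, ∃ u : ℝ → Additive ℝˣ,
      IsPrimitiveAlong U (fun x y ↦ unitRatio (e x y) (v y)) (path σ) u ∧ f.1 σ = u 1 - u 0)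
    (h : ContMDiffRiemannianMetric (𝓡 n) ∞ ℝ l) (a : H1 X ℝ) :
    IsDeRhamClass (holonomyForm D h) a ↔ a = H1.map X lnAbs (H1.mk f) := by
  -- The vectors `v` need not have unit norm; the coboundary of `-logNorm h (v x)` corrects for
  -- this.
  obtain ⟨f', hf', hf'σ⟩ := exists_cocycle_add_coboundary (cocyclesMap X lnAbs f)
    fun x ↦ -logNorm h (v x)
  have key : ∀ σ : Simplex X 1, IsSmoothPath (n := n) σ →
      f'.1 σ = ∫ t in (0 : ℝ)..1, holonomyForm D h (path σ t) (velocity σ t) := by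
    intro σ hσ
    obtain ⟨u, hu, huf⟩ := hf σ
    rw [hU.integral_holonomyForm hv h hσ hu, hf'σ]
    change lnAbs (f.1 σ) + _ = _
    have hu0 := unitVal_ne_zero (u 0)
    have hu1 := unitVal_ne_zero (u 1)
    rw [huf, map_sub, lnAbs_apply, lnAbs_apply, flatSection, flatSection,
      logNorm_smul h (hv _) (inv_ne_zero hu0), logNorm_smul h (hv _) (inv_ne_zero hu1),
      abs_inv, abs_inv, Real.log_inv, Real.log_inv]
    ring
  have hcl : H1.map X lnAbs (H1.mk f) = H1.mk f' := hf'.symm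
  rw [hcl]
  constructor
  · rintro ⟨f'', rfl, hf''⟩
    congr 1
    exact cocycle_ext_of_smooth (n := n) fun σ hσ ↦ by rw [hf'' σ hσ, key σ hσ]
  · rintro rfl
    exact ⟨f', rfl, key⟩

end HolonomyForm

end RealLineBundle

end

/-! ### The main theorem -/

theorem mainTheorem2 {n : ℕ} {X : Type*} [TopologicalSpace X] [T2Space X]
    [SecondCountableTopology X] [ChartedSpace (EuclideanSpace ℝ (Fin n)) X]
    [IsManifold (𝓡 n) ∞ X]
    (l : X → Type*) [TopologicalSpace (TotalSpace ℝ l)]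
    [∀ x, AddCommGroup (l x)] [∀ x, Module ℝ (l x)] [∀ x, TopologicalSpace (l x)]
    [∀ x, IsTopologicalAddGroup (l x)] [∀ x, ContinuousSMul ℝ (l x)]
    [FiberBundle ℝ l] [VectorBundle ℝ ℝ l] [ContMDiffVectorBundle ∞ ℝ l (𝓡 n)]
    (D : CovariantDerivative (𝓡 n) ℝ l) [D.ContMDiffCovariantDerivative ∞]
    (hD : RealLineBundle.IsFlat D) :
    ∃ (c : RealLineBundle.H1 X (Additive ℝˣ)) (w₁ : RealLineBundle.H1 X (Additive ℤˣ))
      (c' : RealLineBundle.H1 X ℝ),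
      -- `c` is the holonomy class of `D`
      (∀ a, RealLineBundle.IsHolonomyClass D a ↔ a = c) ∧
      -- `w₁` is the first Stiefel-Whitney class of `l`
      (∀ a, RealLineBundle.IsFirstStiefelWhitneyClass l a ↔ a = w₁) ∧
      -- `c'` is the class of the holonomy form with respect to an arbitrary fibre metric
      (∀ h : ContMDiffRiemannianMetric (𝓡 n) ∞ ℝ l, ∀ a,
        RealLineBundle.IsDeRhamClass (RealLineBundle.holonomyForm D h) a ↔ a = c') ∧
      -- (a)
      RealLineBundle.H1.map X RealLineBundle.lnAbs c = c' ∧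
      -- (b)
      RealLineBundle.H1.map X RealLineBundle.sign c = w₁ ∧
      (∀ D₂ : CovariantDerivative (𝓡 n) ℝ l, D₂.ContMDiffCovariantDerivative ∞ →
        RealLineBundle.IsFlat D₂ → ∀ c₂, RealLineBundle.IsHolonomyClass D₂ c₂ →
          RealLineBundle.H1.map X RealLineBundle.sign c₂ =
            RealLineBundle.H1.map X RealLineBundle.sign c) ∧
      -- (c)
      Function.Bijective (RealLineBundle.decomposition X) ∧
      RealLineBundle.decomposition X (w₁, c') = c := by
  obtain ⟨v, hv⟩ := RealLineBundle.exists_ne_zero_section l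
  -- Stated for every flat connection, because independence of the connection is obtained by
  -- applying it to `D₂` as well: both signs are Stiefel-Whitney classes of `l`, and that class is
  -- unique.
  have construct : ∀ D' : CovariantDerivative (𝓡 n) ℝ l, D'.ContMDiffCovariantDerivative ∞ →
      RealLineBundle.IsFlat D' → ∃ c, (∀ a, RealLineBundle.IsHolonomyClass D' a ↔ a = c) ∧
        RealLineBundle.IsFirstStiefelWhitneyClass l
          (RealLineBundle.H1.map X RealLineBundle.sign c) ∧
        ∀ h : ContMDiffRiemannianMetric (𝓡 n) ∞ ℝ l, ∀ a,
          RealLineBundle.IsDeRhamClass (RealLineBundle.holonomyForm D' h) a ↔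
            a = RealLineBundle.H1.map X RealLineBundle.lnAbs c := by
    intro D' _ hD'
    obtain ⟨U, e, hU⟩ := RealLineBundle.exists_isFlatAtlas D' hD'
    obtain ⟨f, hf⟩ := RealLineBundle.exists_cocycle_of_isLocalPotential (hU.isLocalPotential hv)
    exact ⟨RealLineBundle.H1.mk f, hU.isHolonomyClass_iff hv hf,
      hU.isFirstStiefelWhitneyClass hv hf, fun h a ↦ hU.isDeRhamClass_iff hv hf h a⟩
  obtain ⟨c, hc, hw, hdR⟩ := construct D inferInstance hD
  refine ⟨c, RealLineBundle.H1.map X RealLineBundle.sign c,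
    RealLineBundle.H1.map X RealLineBundle.lnAbs c, hc,
    fun a ↦ ⟨fun ha ↦ ha.eq hw, fun ha ↦ ha ▸ hw⟩, hdR, rfl, rfl, ?_,
    RealLineBundle.decomposition_bijective, RealLineBundle.decomposition_sign_lnAbs c⟩
  intro D₂ hD₂ hflat c₂ hc₂
  obtain ⟨c₃, hc₃, hw₃, -⟩ := construct D₂ hD₂ hflat
  rw [(hc₃ c₂).1 hc₂]
  exact hw₃.eq hw
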